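/- **Conventions.** Let $k$ be a field of characteristic zero, $\otimes=\otimes_k$, and use Sweedler notation $\Delta(x)=x^{(1)}\otimes x^{(2)}$; $\gamma$ denotes antipodes and $\varepsilon$ counits. Let $\mathcal U$ be a quasitriangular Hopf algebra with universal R-matrix $\mathcal R\in\mathcal U\otimes\mathcal U$, that is, $\mathcal R$ is invertible, $\mathcal R\,\Delta(x)=\Delta^{op}(x)\,\mathcal R$, $(\Delta\otimes\mathrm{id})\mathcal R=\mathcal R_{13}\mathcal R_{23}$, $(\mathrm{id}\otimes\Delta)\mathcal R=\mathcal R_{13}\mathcal R_{12}$; its antipode is then bijective. Let $\mathcal H\subset\mathcal U$ be a Hopf subalgebra and let $\mathcal L$ be an $\mathcal H$-base algebra: an algebra that is a left $\mathcal H$-module algebra (action $\triangleright$) and a left $\mathcal H$-comodule algebra (coaction $\delta(\lambda)=\lambda^{(1)}\otimes\lambda^{[\infty]}\in\mathcal H\otimes\mathcal L$), such that $h^{(1)}\lambda^{(1)}\otimes h^{(2)}\triangleright\lambda^{[\infty]}=(h^{(1)}\triangleright\lambda)^{(1)}h^{(2)}\otimes(h^{(1)}\triangleright\lambda)^{[\infty]}$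 and $\lambda\mu=(\lambda^{(1)}\triangleright\mu)\lambda^{[\infty]}$ for all $h\in\mathcal H$, $\lambda,\mu\in\mathcal L$. A dynamical twist is an invertible element $\mathcal F=\mathcal F_1\otimes\mathcal F_2\otimes\mathcal F_{\mathcal L}\in\mathcal U\otimes\mathcal U\otimes\mathcal L$ satisfying - $\Delta(h^{(1)})(\mathcal F_1\otimes\mathcal F_2)\otimes h^{(2)}\triangleright\mathcal F_{\mathcal L}=(\mathcal F_1\otimes\mathcal F_2)\Delta(h)\otimes\mathcal F_{\mathcal L}$ for all $h\in\mathcal H$, - $\mathcal F_{(12)3}\,\mathcal F_{12|3}=\mathcal F_{1(23)}\,\mathcal F_{23}$ in $\mathcal U^{\otimes3}\otimes\mathcal L$, where $\mathcal F_{(12)3}=(\Delta\otimes\mathrm{id}\otimes\mathrm{id})\mathcal F$, $\mathcal F_{1(23)}=(\mathrm{id}\otimes\Delta\otimes\mathrm{id})\mathcal F$, $\mathcal F_{12|3}=(\mathrm{id}\otimes\mathrm{id}\otimes\delta)\mathcal F$, $\mathcal F_{23}=1\otimes\mathcal F$, - $(\varepsilon\otimes\mathrm{id}\otimes\mathrm{id})\mathcal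 F=1=(\mathrm{id}\otimes\varepsilon\otimes\mathrm{id})\mathcal F$. Fix such an $\mathcal F$, write $\bar{\mathcal F}=\mathcal F^{-1}$ and put $$\tilde{\mathcal R}=\bar{\mathcal F}_{21}\mathcal R\mathcal F,\qquad \mu=\mathcal R_1\gamma(\mathcal R_2),\qquad \vartheta=\gamma(\mathcal F_1)\mathcal F_2\otimes\mathcal F_{\mathcal L},\qquad \zeta=\bar{\mathcal F}_2\gamma^{-1}(\bar{\mathcal F}_1)\otimes\bar{\mathcal F}_{\mathcal L}.$$ Let $(V,\rho)$ be a finite-dimensional $\mathcal U$-module with a basis, $P$ the flip of $V\otimes V$, and $\tilde S=P\tilde R\in\mathrm{End}(V)^{\otimes2}\otimes\mathcal L$, where $\tilde R$ is the image of $\tilde{\mathcal R}$. Let $K=(K_{ij})$ be a $\dim V\times\dim V$ matrix of free generators. The free algebra $k\langle K_{ij}\rangle$ is the $\mathcal H$-module algebra determined by $h\blacktriangleright K=\rho(\gamma(h^{(1)}))K\rho(h^{(2)})$, and $k\langle K_{ij}\rangle\rtimes\mathcal L$ is the space $k\langle K_{ij}\rangle\otimes\mathcal L$ with multiplication $(a\otimes\lambda)(b\otimes\nu)=a(\lambda^{(1)}\blacktriangleright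 b)\otimes\lambda^{[\infty]}\nu$. The dynamical reflection equation (dRE) algebra $\tilde{\mathcal K}$ is the quotient of $k\langle K_{ij}\rangle\rtimes\mathcal L$ by the two-sided ideal generated by the entries of $$\tilde S K_2\tilde S K_2=K_2\tilde S K_2\tilde S,\qquad K_2=1\otimes K.$$ For a square matrix $X$ of size $\dim V$ with entries in $\tilde{\mathcal K}$ define the dynamical trace $\mathrm{Tr}_d(X):=\mathrm{Tr}(\mu\vartheta X\zeta)\in\tilde{\mathcal K}$, where $\mu$ is replaced by $\rho(\mu)$, and $\vartheta,\zeta$ by their images under $\rho\otimes\mathrm{id}$, regarded as matrices over $\tilde{\mathcal K}$ through $\mathcal L\to\tilde{\mathcal K}$. **Theorem.** For every integer $n\ge0$ the element $\mathrm{Tr}_d(K^n)$ lies in the center of the dRE algebra $\tilde{\mathcal K}$. -/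

import Mathlib

open scoped TensorProduct

noncomputable section

namespace DynRE

/-! ### Module algebras, base algebras and smash products -/

section Smash

variable {k H A L : Type*} [Field k] [Ring H] [HopfAlgebra k H] [Ring A] [Algebra k A]
  [Ring L] [Algebra k L]

/-- A structure of left `H`-module algebra on `A`; `act h a` is `h ▹ a`. -/
structure ModuleAlgebra (k H A : Type*) [Field k] [Ring H] [HopfAlgebra k H] [Ring A]
    [Algebra k A] where
  /-- the action, an algebra homomorphism `H → End_k(A)` -/
  act : H →ₐ[k] Module.End k A
  /-- `h ▹ 1 = ε(h) 1` -/
  act_one : ∀ h : H, act h 1 = algebraMap k A (Coalgebra.counit h)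
  /-- `h ▹ (a b) = (h⁽¹⁾ ▹ a) (h⁽²⁾ ▹ b)` -/
  act_mul : ∀ (h : H) (a b : A), act h (a * b) =
    LinearMap.mul' k A (TensorProduct.map (act.toLinearMap.flip a) (act.toLinearMap.flip b)
      (Coalgebra.comul (R := k) h))

/-- An `H`-base algebra structure on `L`: a left `H`-module algebra and left `H`-comodule algebra,
which is a Yetter-Drinfeld module and is quasi-commutative. -/
structure BaseAlgebra (k H L : Type*) [Field k] [Ring H] [HopfAlgebra k H] [Ring L]
    [Algebra k L] extends ModuleAlgebra k H L where
  /-- the coaction `δ(l) = l⁽¹⁾ ⊗ l^[∞]`, a homomorphism of algebras -/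
  coact : L →ₐ[k] H ⊗[k] L
  /-- `(Δ ⊗ id) ∘ δ = (id ⊗ δ) ∘ δ` -/
  coact_coassoc : ∀ l : L,
    TensorProduct.assoc k H H L ((Coalgebra.comul (R := k) (A := H)).rTensor L (coact l)) =
      coact.toLinearMap.lTensor H (coact l)
  /-- `(ε ⊗ id) ∘ δ = id` -/
  coact_counit : ∀ l : L,
    (Coalgebra.counit (R := k) (A := H)).rTensor L (coact l) = 1 ⊗ₜ[k] l
  /-- `h⁽¹⁾ l⁽¹⁾ ⊗ h⁽²⁾ ▹ l^[∞] = (h⁽¹⁾ ▹ l)⁽¹⁾ h⁽²⁾ ⊗ (h⁽¹⁾ ▹ l)^[∞]` -/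
  yetter_drinfeld : ∀ (h : H) (l : L),
    TensorProduct.map (LinearMap.mul' k H) (TensorProduct.lift act.toLinearMap)
        (TensorProduct.tensorTensorTensorComm k H H H L
          (Coalgebra.comul (R := k) h ⊗ₜ[k] coact l)) =
      LinearMap.mul' k (H ⊗[k] L)
        (TensorProduct.map (coact.toLinearMap ∘ₗ act.toLinearMap.flip l)
          (Algebra.TensorProduct.includeLeft : H →ₐ[k] H ⊗[k] L).toLinearMap
          (Coalgebra.comul (R := k) h))
  /-- `l m = (l⁽¹⁾ ▹ m) l^[∞]` -/
  quasi_comm : ∀ l m : L, l * m =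
    LinearMap.mul' k L
      (TensorProduct.map (act.toLinearMap.flip m) LinearMap.id (coact l))

/-- Left multiplication by `A` on `A ⊗ L`. -/
def smashLeft (k A L : Type*) [Field k] [Ring A] [Algebra k A] [Ring L] [Algebra k L] :
    A →ₐ[k] Module.End k (A ⊗[k] L) :=
  (Module.endTensorEndAlgHom (R := k) (S := k) (A := k) (M := A) (N := L)).comp
    (Algebra.TensorProduct.includeLeft.comp (Algebra.lmul k A))

@[simp] lemma smashLeft_tmul (a b : A) (m : L) :
    smashLeft k A L a (b ⊗ₜ[k] m) = (a * b) ⊗ₜ[k] m := by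
  simp [smashLeft, Module.endTensorEndAlgHom_apply]

/-- The action of `H ⊗ L` on `A ⊗ L` in which `H` acts on `A` and `L` multiplies `L`. -/
def smashTensor (α : ModuleAlgebra k H A) (L : Type*) [Ring L] [Algebra k L] :
    H ⊗[k] L →ₐ[k] Module.End k (A ⊗[k] L) :=
  (Module.endTensorEndAlgHom (R := k) (S := k) (A := k) (M := A) (N := L)).comp
    (Algebra.TensorProduct.map α.act (Algebra.lmul k L))

@[simp] lemma smashTensor_tmul (α : ModuleAlgebra k H A) (h : H) (l m : L) (a : A) :
    smashTensor α L (h ⊗ₜ[k] l) (a ⊗ₜ[k] m) = (α.act h a) ⊗ₜ[k] (l * m) := by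
  simp [smashTensor, Module.endTensorEndAlgHom_apply]

/-- Left multiplication by `L` in the smash product:
`l · (a ⊗ m) = (l⁽¹⁾ ▹ a) ⊗ l^[∞] m`. -/
def smashRight (α : ModuleAlgebra k H A) (B : BaseAlgebra k H L) :
    L →ₐ[k] Module.End k (A ⊗[k] L) :=
  (smashTensor α L).comp B.coact

/-- The multiplication of the smash product:
`(a ⊗ l) (b ⊗ m) = a (l⁽¹⁾ ▹ b) ⊗ l^[∞] m`. -/
def smashMul (α : ModuleAlgebra k H A) (B : BaseAlgebra k H L) :
    A ⊗[k] L →ₗ[k] A ⊗[k] L →ₗ[k] A ⊗[k] L :=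
  LinearMap.mul' k (Module.End k (A ⊗[k] L)) ∘ₗ
    TensorProduct.map (smashLeft k A L).toLinearMap (smashRight α B).toLinearMap

lemma smashMul_tmul (α : ModuleAlgebra k H A) (B : BaseAlgebra k H L) (a : A) (l : L)
    (y : A ⊗[k] L) :
    smashMul α B (a ⊗ₜ[k] l) y = smashLeft k A L a (smashRight α B l y) := by
  simp [smashMul]

lemma smashRight_mul_smashLeft (α : ModuleAlgebra k H A) (B : BaseAlgebra k H L) (l : L) (b : A) :
    smashRight α B l * smashLeft k A L b =
      LinearMap.mul' k (Module.End k (A ⊗[k] L))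
        (TensorProduct.map ((smashLeft k A L).toLinearMap ∘ₗ α.act.toLinearMap.flip b)
          (smashRight α B).toLinearMap (B.coact l)) := by
  have h1 : ∀ t : H ⊗[k] L, smashTensor α L t * smashLeft k A L b =
      LinearMap.mul' k (Module.End k (A ⊗[k] L))
        (TensorProduct.map ((smashLeft k A L).toLinearMap ∘ₗ α.act.toLinearMap.flip b)
          (smashTensor α L).toLinearMap
          (TensorProduct.assoc k H H L
            ((Coalgebra.comul (R := k) (A := H)).rTensor L t))) := by
    intro t
    induction t with
    | zero => simp
    | add x y hx hy => simp only [map_add, add_mul, hx, hy]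
    | tmul h m =>
      ext c n
      have key : ∀ s : H ⊗[k] H, LinearMap.mul' k (Module.End k (A ⊗[k] L))
          (TensorProduct.map ((smashLeft k A L).toLinearMap ∘ₗ α.act.toLinearMap.flip b)
            (smashTensor α L).toLinearMap
            (TensorProduct.assoc k H H L (s ⊗ₜ[k] m))) (c ⊗ₜ[k] n) =
          LinearMap.mul' k A (TensorProduct.map (α.act.toLinearMap.flip b)
            (α.act.toLinearMap.flip c) s) ⊗ₜ[k] (m * n) := by
        intro s
        induction s with
        | zero => simp
        | add x y hx hy =>
          simp only [map_add, TensorProduct.add_tmul, LinearMap.add_apply, hx, hy]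
        | tmul x y => simp
      simp [key, α.act_mul]
  have h2 : ∀ t : H ⊗[k] L,
      TensorProduct.map ((smashLeft k A L).toLinearMap ∘ₗ α.act.toLinearMap.flip b)
          (smashTensor α L).toLinearMap (B.coact.toLinearMap.lTensor H t) =
      TensorProduct.map ((smashLeft k A L).toLinearMap ∘ₗ α.act.toLinearMap.flip b)
          (smashRight α B).toLinearMap t := by
    intro t
    induction t with
    | zero => simp
    | add x y hx hy => simp only [map_add, hx, hy]
    | tmul h m => simp [smashRight]
  rw [← h2, ← B.coact_coassoc, ← h1]
  simp [smashRight]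

lemma smashMul_smashLeft (α : ModuleAlgebra k H A) (B : BaseAlgebra k H L) (a : A)
    (z : A ⊗[k] L) :
    smashMul α B (smashLeft k A L a z) = smashLeft k A L a * smashMul α B z := by
  induction z with
  | zero => simp
  | add x y hx hy => simp only [map_add, mul_add, hx, hy]
  | tmul b m =>
    refine LinearMap.ext fun w => ?_
    simp [smashMul_tmul]

lemma smashMul_smashRight (α : ModuleAlgebra k H A) (B : BaseAlgebra k H L) (l : L)
    (z : A ⊗[k] L) :
    smashMul α B (smashRight α B l z) = smashRight α B l * smashMul α B z := by
  induction z with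
  | zero => simp
  | add x y hx hy => simp only [map_add, mul_add, hx, hy]
  | tmul b m =>
    have h3 : smashMul α B (b ⊗ₜ[k] m) = smashLeft k A L b * smashRight α B m := by
      refine LinearMap.ext fun w => ?_
      simp [smashMul_tmul]
    rw [h3, ← mul_assoc, smashRight_mul_smashLeft]
    have h4 : ∀ t : H ⊗[k] L, smashMul α B (smashTensor α L t (b ⊗ₜ[k] m)) =
        LinearMap.mul' k (Module.End k (A ⊗[k] L))
        (TensorProduct.map ((smashLeft k A L).toLinearMap ∘ₗ α.act.toLinearMap.flip b)
          (smashRight α B).toLinearMap t) * smashRight α B m := by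
      intro t
      induction t with
      | zero => simp
      | add x y hx hy => simp only [map_add, add_mul, LinearMap.add_apply, hx, hy]
      | tmul h n =>
        refine LinearMap.ext fun w => ?_
        simp [smashMul_tmul]
    exact h4 _

lemma smashMul_assoc (α : ModuleAlgebra k H A) (B : BaseAlgebra k H L) (x y z : A ⊗[k] L) :
    smashMul α B (smashMul α B x y) z = smashMul α B x (smashMul α B y z) := by
  induction x with
  | zero => simp
  | add x x' hx hy => simp only [map_add, LinearMap.add_apply, hx, hy]
  | tmul a l => simp [smashMul_tmul, smashMul_smashLeft, smashMul_smashRight]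

lemma smashTensor_one_tmul (α : ModuleAlgebra k H A) (m : L) (t : H ⊗[k] L) :
    smashTensor α L t ((1 : A) ⊗ₜ[k] m) =
      TensorProduct.map (Algebra.linearMap k A) (LinearMap.mulRight k m)
        ((Coalgebra.counit (R := k) (A := H)).rTensor L t) := by
  induction t with
  | zero => simp
  | add x y hx hy => simp only [map_add, LinearMap.add_apply, hx, hy]
  | tmul h n => simp [α.act_one]

lemma smashMul_one_tmul (α : ModuleAlgebra k H A) (B : BaseAlgebra k H L) (a : A) (l m : L) :
    smashMul α B (a ⊗ₜ[k] l) ((1 : A) ⊗ₜ[k] m) = a ⊗ₜ[k] (l * m) := by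
  simp [smashMul_tmul, smashRight, smashTensor_one_tmul, B.coact_counit]

lemma smashMul_one (α : ModuleAlgebra k H A) (B : BaseAlgebra k H L) (x : A ⊗[k] L) :
    smashMul α B x ((1 : A) ⊗ₜ[k] (1 : L)) = x := by
  induction x with
  | zero => simp
  | add x y hx hy => simp only [map_add, LinearMap.add_apply, hx, hy]
  | tmul a l => simp [smashMul_one_tmul]

lemma one_smashMul (α : ModuleAlgebra k H A) (B : BaseAlgebra k H L) (x : A ⊗[k] L) :
    smashMul α B ((1 : A) ⊗ₜ[k] (1 : L)) x = x := by
  simp [smashMul_tmul]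

/-- The smash product `A ⋊ L` of an `H`-module algebra `A` and an `H`-base algebra `L`: the space
`A ⊗ L` with the multiplication `(a ⊗ l) (b ⊗ m) = a (l⁽¹⁾ ▹ b) ⊗ l^[∞] m`. -/
def SmashProduct (_α : ModuleAlgebra k H A) (_B : BaseAlgebra k H L) : Type _ := A ⊗[k] L

namespace SmashProduct

variable (α : ModuleAlgebra k H A) (B : BaseAlgebra k H L)

instance : AddCommGroup (SmashProduct α B) := inferInstanceAs (AddCommGroup (A ⊗[k] L))

instance : Module k (SmashProduct α B) := inferInstanceAs (Module k (A ⊗[k] L))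

instance : Ring (SmashProduct α B) :=
  { (inferInstance : AddCommGroup (SmashProduct α B)) with
    mul := fun x y => smashMul α B x y
    one := (1 : A) ⊗ₜ[k] (1 : L)
    mul_assoc := smashMul_assoc α B
    one_mul := one_smashMul α B
    mul_one := smashMul_one α B
    left_distrib := fun x y z => map_add (smashMul α B x) y z
    right_distrib := fun x y z => LinearMap.map_add₂ (smashMul α B) x y z
    zero_mul := fun x => LinearMap.map_zero₂ (smashMul α B) x
    mul_zero := fun x => map_zero (smashMul α B x) }

instance : Algebra k (SmashProduct α B) :=
  Algebra.ofModule (fun r x y => LinearMap.map_smul₂ (smashMul α B) r x y)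
    (fun r x y => map_smul (smashMul α B x) r y)

/-- The embedding `a ↦ a ⊗ 1` of `A` in the smash product. -/
def inl (a : A) : SmashProduct α B := (a ⊗ₜ[k] (1 : L) : A ⊗[k] L)

/-- The embedding `l ↦ 1 ⊗ l` of `L` in the smash product, a homomorphism of algebras. -/
def inr : L →ₐ[k] SmashProduct α B :=
  AlgHom.ofLinearMap (TensorProduct.mk k A L 1 : L →ₗ[k] A ⊗[k] L) rfl
    (fun l m => (smashMul_one_tmul α B 1 l m).symm)

end SmashProduct

end Smash

/-! ### The free algebra on the matrix `K` with the coadjoint action -/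

section Coadjoint

variable {k H ι : Type*} [Field k] [Ring H] [HopfAlgebra k H] [Fintype ι] [DecidableEq ι]

/-- The linear functional `h ↦ π(γ(h⁽¹⁾))_{ia} π(h⁽²⁾)_{bj}` on `H`. -/
def coadjointCoeff (π : H →ₐ[k] Matrix ι ι k) (i a b j : ι) : H →ₗ[k] k :=
  LinearMap.mul' k k ∘ₗ
    TensorProduct.map
      (Matrix.entryLinearMap k k i a ∘ₗ π.toLinearMap ∘ₗ HopfAlgebra.antipode k)
      (Matrix.entryLinearMap k k b j ∘ₗ π.toLinearMap) ∘ₗ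
    Coalgebra.comul

/-- `h ↦ (π(γ(h⁽¹⁾)) K π(h⁽²⁾))_{ij}`, where `K` is the matrix of free generators. -/
def coadjointGen (π : H →ₐ[k] Matrix ι ι k) (p : ι × ι) : H →ₗ[k] FreeAlgebra k (ι × ι) :=
  ∑ a, ∑ b, (coadjointCoeff π p.1 a b p.2).smulRight (FreeAlgebra.ι k (a, b))

/-- The extension of the coadjoint action from the generators to the free algebra by the rule
`h ▹ (x y) = (h⁽¹⁾ ▹ x) (h⁽²⁾ ▹ y)`: a homomorphism into the convolution algebra. -/
def coadjointConv (π : H →ₐ[k] Matrix ι ι k) :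
    FreeAlgebra k (ι × ι) →ₐ[k] WithConv (H →ₗ[k] FreeAlgebra k (ι × ι)) :=
  FreeAlgebra.lift k fun p => WithConv.toConv (coadjointGen π p)

lemma coadjointConv_one (π : H →ₐ[k] Matrix ι ι k) (x : FreeAlgebra k (ι × ι)) :
    (coadjointConv π x).ofConv 1 = x := by
  induction x using FreeAlgebra.induction with
  | grade0 r => simp [Algebra.algebraMap_eq_smul_one]
  | grade1 p =>
    simp [coadjointConv, coadjointGen, coadjointCoeff, Algebra.TensorProduct.one_def,
      Matrix.one_apply]
  | mul x y hx hy =>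
    rw [map_mul, LinearMap.convMul_apply]
    simp [Algebra.TensorProduct.one_def, hx, hy]
  | add x y hx hy => simp [hx, hy]

/-- The linear map `H → End_k(k⟨K⟩)` underlying the coadjoint action. -/
def coadjointLin (π : H →ₐ[k] Matrix ι ι k) : H →ₗ[k] Module.End k (FreeAlgebra k (ι × ι)) :=
  ((WithConv.linearEquiv k (H →ₗ[k] FreeAlgebra k (ι × ι))).toLinearMap ∘ₗ
    (coadjointConv π).toLinearMap).flip

@[simp] lemma coadjointLin_apply (π : H →ₐ[k] Matrix ι ι k) (h : H) (x : FreeAlgebra k (ι × ι)) :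
    coadjointLin π h x = (coadjointConv π x).ofConv h := rfl

lemma coadjointLin_mul' (π : H →ₐ[k] Matrix ι ι k) (h : H) (x y : FreeAlgebra k (ι × ι)) :
    coadjointLin π h (x * y) =
      LinearMap.mul' k _ (TensorProduct.map ((coadjointLin π).flip x) ((coadjointLin π).flip y)
        (Coalgebra.comul (R := k) h)) := by
  rw [coadjointLin_apply, map_mul, LinearMap.convMul_apply]
  rfl

lemma coadjointCoeff_mul (π : H →ₐ[k] Matrix ι ι k) (i c d j : ι) (h g : H) :
    coadjointCoeff π i c d j (h * g) =
      ∑ a, ∑ b, coadjointCoeff π i a b j g * coadjointCoeff π a c d b h := by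
  have key : ∀ s t : H ⊗[k] H,
      LinearMap.mul' k k (TensorProduct.map
        (Matrix.entryLinearMap k k i c ∘ₗ π.toLinearMap ∘ₗ HopfAlgebra.antipode k)
        (Matrix.entryLinearMap k k d j ∘ₗ π.toLinearMap) (s * t)) =
      ∑ a, ∑ b, LinearMap.mul' k k (TensorProduct.map
        (Matrix.entryLinearMap k k i a ∘ₗ π.toLinearMap ∘ₗ HopfAlgebra.antipode k)
        (Matrix.entryLinearMap k k b j ∘ₗ π.toLinearMap) t) *
        LinearMap.mul' k k (TensorProduct.map
        (Matrix.entryLinearMap k k a c ∘ₗ π.toLinearMap ∘ₗ HopfAlgebra.antipode k)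
        (Matrix.entryLinearMap k k d b ∘ₗ π.toLinearMap) s) := by
    intro s t
    induction s with
    | zero => simp
    | add x y hx hy => simp only [map_add, add_mul, mul_add, hx, hy, Finset.sum_add_distrib]
    | tmul x y =>
      induction t with
      | zero => simp
      | add u v hu hv => simp only [map_add, add_mul, mul_add, hu, hv, Finset.sum_add_distrib]
      | tmul u v =>
        simp only [Algebra.TensorProduct.tmul_mul_tmul, TensorProduct.map_tmul,
          LinearMap.comp_apply, LinearMap.mul'_apply, AlgHom.toLinearMap_apply,
          HopfAlgebra.antipode_mul_antidistrib, map_mul, Matrix.entryLinearMap_apply,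
          Matrix.mul_apply, Finset.sum_mul_sum]
        refine Finset.sum_congr rfl fun a _ => Finset.sum_congr rfl fun b _ => ?_
        ring
  have := key (Coalgebra.comul h) (Coalgebra.comul g)
  rw [← Bialgebra.comul_mul] at this
  exact this

lemma coadjointLin_hmul (π : H →ₐ[k] Matrix ι ι k) (h g : H) (x : FreeAlgebra k (ι × ι)) :
    coadjointLin π (h * g) x = coadjointLin π h (coadjointLin π g x) := by
  induction x using FreeAlgebra.induction generalizing h g with
  | grade0 r =>
    simp [Algebra.algebraMap_eq_smul_one, smul_smul, mul_comm, mul_left_comm]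
  | grade1 p =>
    have hgen : ∀ (q : ι × ι) (y : H), coadjointLin π y (FreeAlgebra.ι k q) =
        ∑ a, ∑ b, coadjointCoeff π q.1 a b q.2 y • FreeAlgebra.ι k (a, b) := by
      intro q y
      simp [coadjointConv, coadjointGen]
    simp only [hgen, map_sum, map_smul, coadjointCoeff_mul, Finset.sum_smul, Finset.smul_sum,
      smul_smul]
    simp only [← Fintype.sum_prod_type']
    exact Fintype.sum_equiv ((Equiv.prodAssoc ι ι (ι × ι)).symm.trans
      ((Equiv.prodComm _ _).trans (Equiv.prodAssoc ι ι (ι × ι)))) _ _ fun x => rfl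
  | mul x y hx hy =>
    rw [coadjointLin_mul', coadjointLin_mul' π g, Bialgebra.comul_mul]
    generalize Coalgebra.comul (R := k) g = t
    induction t with
    | zero => simp
    | add t t' ht ht' => simp only [mul_add, map_add, ht, ht']
    | tmul u v =>
      rw [TensorProduct.map_tmul, LinearMap.mul'_apply, coadjointLin_mul']
      generalize Coalgebra.comul (R := k) h = s
      induction s with
      | zero => simp
      | add s s' hs hs' => simp only [add_mul, map_add, hs, hs']
      | tmul r q =>
        simp only [Algebra.TensorProduct.tmul_mul_tmul, TensorProduct.map_tmul,
          LinearMap.mul'_apply, LinearMap.flip_apply, hx, hy]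
  | add x y hx hy => simp only [map_add, hx, hy]

/-- The left `H`-module algebra `k⟨K⟩`, the free algebra on the entries of the matrix `K`, with the
action determined by `h ▹ K = π(γ(h⁽¹⁾)) K π(h⁽²⁾)`. -/
def coadjoint (π : H →ₐ[k] Matrix ι ι k) : ModuleAlgebra k H (FreeAlgebra k (ι × ι)) where
  act := AlgHom.ofLinearMap (coadjointLin π)
    (LinearMap.ext fun x => coadjointConv_one π x)
    (fun h g => LinearMap.ext fun x => coadjointLin_hmul π h g x)
  act_one h := by
    change (coadjointConv π 1).ofConv h = _
    simp
  act_mul h x y := coadjointLin_mul' π h x y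

end Coadjoint

/-! ### The dynamical reflection equation algebra -/

section DREAlgebra

open scoped Kronecker

variable {k H L ι : Type*} [Field k] [Ring H] [HopfAlgebra k H] [Ring L] [Algebra k L]
  [Fintype ι] [DecidableEq ι]

/-- The matrix `X₂ = 1 ⊗ X` acting in the second factor of `V ⊗ V`. -/
def secondLeg {A : Type*} [Ring A] (X : Matrix ι ι A) : Matrix (ι × ι) (ι × ι) A :=
  (1 : Matrix ι ι A) ⊗ₖ X

/-- The matrix `K` of generators with entries in `k⟨K⟩ ⋊ L`. -/
def freeK (π : H →ₐ[k] Matrix ι ι k) (B : BaseAlgebra k H L) :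
    Matrix ι ι (SmashProduct (coadjoint π) B) :=
  Matrix.of fun i j => SmashProduct.inl (coadjoint π) B (FreeAlgebra.ι k (i, j))

/-- The defining relations of the dRE algebra, `S K₂ S K₂ = K₂ S K₂ S`, entry by entry. -/
inductive DRERel (π : H →ₐ[k] Matrix ι ι k) (B : BaseAlgebra k H L)
    (S : Matrix (ι × ι) (ι × ι) L) :
    SmashProduct (coadjoint π) B → SmashProduct (coadjoint π) B → Prop
  | entry (p q : ι × ι) : DRERel π B S
      ((S.map (SmashProduct.inr (coadjoint π) B) * secondLeg (freeK π B) *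
        S.map (SmashProduct.inr (coadjoint π) B) * secondLeg (freeK π B)) p q)
      ((secondLeg (freeK π B) * S.map (SmashProduct.inr (coadjoint π) B) *
        secondLeg (freeK π B) * S.map (SmashProduct.inr (coadjoint π) B)) p q)

/-- The dynamical reflection equation algebra associated with the matrix `S` with entries in the
base algebra `L`: the quotient of `k⟨K⟩ ⋊ L` by the relations `S K₂ S K₂ = K₂ S K₂ S`. -/
abbrev DREAlgebra (π : H →ₐ[k] Matrix ι ι k) (B : BaseAlgebra k H L)
    (S : Matrix (ι × ι) (ι × ι) L) : Type _ :=
  RingQuot (DRERel π B S)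

/-- The matrix `K` of generators of the dRE algebra. -/
def dreK (π : H →ₐ[k] Matrix ι ι k) (B : BaseAlgebra k H L) (S : Matrix (ι × ι) (ι × ι) L) :
    Matrix ι ι (DREAlgebra π B S) :=
  (freeK π B).map (RingQuot.mkAlgHom k (DRERel π B S))

/-- The canonical homomorphism from the base algebra `L` to the dRE algebra. -/
def dreSource (π : H →ₐ[k] Matrix ι ι k) (B : BaseAlgebra k H L) (S : Matrix (ι × ι) (ι × ι) L) :
    L →ₐ[k] DREAlgebra π B S :=
  (RingQuot.mkAlgHom k (DRERel π B S)).comp (SmashProduct.inr (coadjoint π) B)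

end DREAlgebra

/-! ### Universal R-matrices and dynamical twists -/

section Twist

variable {k H U L : Type*} [Field k] [Ring H] [HopfAlgebra k H] [Ring U] [HopfAlgebra k U]
  [Ring L] [Algebra k L]

/-- The inverse of the antipode. It exists whenever `U` is quasitriangular; the value `0` in the
other case is a convention. -/
def antipodeInv (k U : Type*) [Field k] [Ring U] [HopfAlgebra k U] : U →ₗ[k] U :=
  open scoped Classical in
  if h : Function.Bijective (HopfAlgebra.antipode k (A := U)) then
    (LinearEquiv.ofBijective (HopfAlgebra.antipode k (A := U)) h).symm.toLinearMap
  else 0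

/-- `(Δ ⊗ id)(x)`, for `x ∈ U ⊗ M`. -/
def comulFirst (k U M : Type*) [Field k] [Ring U] [HopfAlgebra k U] [Ring M] [Algebra k M] :
    U ⊗[k] M →ₐ[k] U ⊗[k] (U ⊗[k] M) :=
  (Algebra.TensorProduct.assoc k k k U U M).toAlgHom.comp
    (Algebra.TensorProduct.map (Bialgebra.comulAlgHom k U) (AlgHom.id k M))

/-- `(ε ⊗ id)(x)`, for `x ∈ U ⊗ M`. -/
def counitFirst (k U M : Type*) [Field k] [Ring U] [HopfAlgebra k U] [Ring M] [Algebra k M] :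
    U ⊗[k] M →ₐ[k] M :=
  (Algebra.TensorProduct.lid k M).toAlgHom.comp
    (Algebra.TensorProduct.map (Bialgebra.counitAlgHom k U) (AlgHom.id k M))

/-- `id ⊗ f`. -/
def onRight (U : Type*) {k M N : Type*} [Field k] [Ring U] [Algebra k U] [Ring M] [Algebra k M]
    [Ring N] [Algebra k N] (f : M →ₐ[k] N) : U ⊗[k] M →ₐ[k] U ⊗[k] N :=
  Algebra.TensorProduct.map (AlgHom.id k U) f

/-- `R` is a universal R-matrix (quasitriangular structure) of the Hopf algebra `U`. -/
structure IsUniversalRMatrix (R : (U ⊗[k] U)ˣ) : Prop where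
  /-- `R Δ(x) = Δᵒᵖ(x) R` -/
  intertwines : ∀ x : U, (R : U ⊗[k] U) * Coalgebra.comul x =
    TensorProduct.comm k U U (Coalgebra.comul x) * (R : U ⊗[k] U)
  /-- `(Δ ⊗ id)(R) = R₁₃ R₂₃` -/
  comul_left : comulFirst k U U R =
    onRight U (Algebra.TensorProduct.includeRight : U →ₐ[k] U ⊗[k] U) R * (1 ⊗ₜ[k] (R : U ⊗[k] U))
  /-- `(id ⊗ Δ)(R) = R₁₃ R₁₂` -/
  comul_right : onRight U (Bialgebra.comulAlgHom k U) R =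
    onRight U (Algebra.TensorProduct.includeRight : U →ₐ[k] U ⊗[k] U) R *
      onRight U (Algebra.TensorProduct.includeLeft : U →ₐ[k] U ⊗[k] U) R

/-- The embedding `U ⊗ U → U ⊗ U ⊗ L`, `x ↦ x ⊗ 1`. -/
def constTensor (k U L : Type*) [Field k] [Ring U] [HopfAlgebra k U] [Ring L] [Algebra k L] :
    U ⊗[k] U →ₐ[k] U ⊗[k] (U ⊗[k] L) :=
  onRight U Algebra.TensorProduct.includeLeft

/-- The coaction followed by the inclusion of `H`: `l ↦ j(l⁽¹⁾) ⊗ l^[∞] ∈ U ⊗ L`. -/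
def coactU (j : H →ₐc[k] U) (B : BaseAlgebra k H L) : L →ₐ[k] U ⊗[k] L :=
  (Algebra.TensorProduct.map (j : H →ₐ[k] U) (AlgHom.id k L)).comp B.coact

/-- `h ↦ F₁ ⊗ F₂ ⊗ (h ▹ F_L)` for `F ∈ U ⊗ U ⊗ L`. -/
def actOnBase (B : BaseAlgebra k H L) (F : U ⊗[k] (U ⊗[k] L)) : H →ₗ[k] U ⊗[k] (U ⊗[k] L) :=
  LinearMap.applyₗ F ∘ₗ LinearMap.lTensorHom U ∘ₗ LinearMap.lTensorHom U ∘ₗ B.act.toLinearMap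

/-- `F` is a dynamical `(U, H, L)`-twist, where `j : H → U` is the inclusion of `H` in `U`. -/
structure IsDynamicalTwist (j : H →ₐc[k] U) (B : BaseAlgebra k H L)
    (F : (U ⊗[k] (U ⊗[k] L))ˣ) : Prop where
  /-- `Δ(h⁽¹⁾) (F₁ ⊗ F₂) ⊗ (h⁽²⁾ ▹ F_L) = (F₁ ⊗ F₂) Δ(h) ⊗ F_L` -/
  invariant : ∀ h : H,
    LinearMap.mul' k (U ⊗[k] (U ⊗[k] L))
        (TensorProduct.map
          ((constTensor k U L).toLinearMap ∘ₗ Coalgebra.comul ∘ₗ (j : H →ₐ[k] U).toLinearMap)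
          (actOnBase B (F : U ⊗[k] (U ⊗[k] L)))
          (Coalgebra.comul (R := k) h)) =
      F * constTensor k U L (Coalgebra.comul (j h))
  /-- `F₍₁₂₎₃ F₁₂|₃ = F₁₍₂₃₎ F₂₃` in `U ⊗ U ⊗ U ⊗ L` -/
  cocycle :
    comulFirst k U (U ⊗[k] L) F * onRight U (onRight U (coactU j B)) F =
      onRight U (comulFirst k U L) F * (1 ⊗ₜ[k] (F : U ⊗[k] (U ⊗[k] L)))
  /-- `ε₁(F) = 1` -/
  counit_left : counitFirst k U (U ⊗[k] L) F = 1
  /-- `ε₂(F) = 1` -/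
  counit_right : onRight U (counitFirst k U L) F = 1

/-- The dynamical R-matrix `F₂₁⁻¹ R F ∈ U ⊗ U ⊗ L`. -/
def dynR (R : (U ⊗[k] U)ˣ) (F : (U ⊗[k] (U ⊗[k] L))ˣ) : U ⊗[k] (U ⊗[k] L) :=
  Algebra.TensorProduct.leftComm k U U L (F⁻¹ : (U ⊗[k] (U ⊗[k] L))ˣ) *
    constTensor k U L R * F

/-- The element `μ = R₁ γ(R₂)` of `U`. -/
def drinfeldMu (R : (U ⊗[k] U)ˣ) : U :=
  LinearMap.mul' k U ((HopfAlgebra.antipode k (A := U)).lTensor U R)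

/-- The element `ϑ = γ(F₁) F₂ ⊗ F_L` of `U ⊗ L`. -/
def theta (F : (U ⊗[k] (U ⊗[k] L))ˣ) : U ⊗[k] L :=
  (LinearMap.mul' k U ∘ₗ (HopfAlgebra.antipode k (A := U)).rTensor U).rTensor L
    ((TensorProduct.assoc k U U L).symm F)

/-- The element `ζ = F̄₂ γ⁻¹(F̄₁) ⊗ F̄_L` of `U ⊗ L`, where `F̄ = F⁻¹`. -/
def zeta (F : (U ⊗[k] (U ⊗[k] L))ˣ) : U ⊗[k] L :=
  (LinearMap.mul' k U ∘ₗ (antipodeInv k U).lTensor U ∘ₗ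
      (TensorProduct.comm k U U).toLinearMap).rTensor L
    ((TensorProduct.assoc k U U L).symm (F⁻¹ : (U ⊗[k] (U ⊗[k] L))ˣ))

end Twist

/-! ### Matrices and the dynamical trace -/

section Trace

variable {k H U L ι : Type*} [Field k] [Ring H] [HopfAlgebra k H] [Ring U] [HopfAlgebra k U]
  [Ring L] [Algebra k L] [Fintype ι] [DecidableEq ι]

/-- The functional `(ρ(·)_{ij} ⊗ id) : U ⊗ M → M`. -/
def entryFirst (ρ : U →ₐ[k] Matrix ι ι k) (M : Type*) [AddCommGroup M] [Module k M] (i j : ι) :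
    U ⊗[k] M →ₗ[k] M :=
  (TensorProduct.lid k M).toLinearMap ∘ₗ
    (Matrix.entryLinearMap k k i j ∘ₗ ρ.toLinearMap).rTensor M

/-- The image of `x ∈ U ⊗ L` in `End(V) ⊗ L`, as a matrix with entries in `L`. -/
def repOne (ρ : U →ₐ[k] Matrix ι ι k) (x : U ⊗[k] L) : Matrix ι ι L :=
  Matrix.of fun i j => entryFirst ρ L i j x

/-- The image of `x ∈ U ⊗ U ⊗ L` in `End(V) ⊗ End(V) ⊗ L`, as a matrix with entries in `L`. -/
def repTwo (ρ : U →ₐ[k] Matrix ι ι k) (x : U ⊗[k] (U ⊗[k] L)) : Matrix (ι × ι) (ι × ι) L :=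
  Matrix.of fun p q => entryFirst ρ L p.2 q.2 (entryFirst ρ (U ⊗[k] L) p.1 q.1 x)

/-- The permutation matrix on `V ⊗ V`. -/
def flipMatrix (ι L : Type*) [DecidableEq ι] [Ring L] : Matrix (ι × ι) (ι × ι) L :=
  Matrix.of fun p q => if p = q.swap then 1 else 0

/-- The dynamical matrix `S̃ = P R̃`, where `R̃` is the image of `F₂₁⁻¹ R F`. -/
def dynS (ρ : U →ₐ[k] Matrix ι ι k) (R : (U ⊗[k] U)ˣ) (F : (U ⊗[k] (U ⊗[k] L))ˣ) :
    Matrix (ι × ι) (ι × ι) L :=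
  flipMatrix ι L * repTwo ρ (dynR R F)

/-- The dynamical trace `Tr_d(X) = Tr(μ ϑ X ζ)` of a matrix `X` with entries in an algebra `A`
that receives a homomorphism `s` from the base algebra `L`. -/
def dynTrace {A : Type*} [Ring A] [Algebra k A] (ρ : U →ₐ[k] Matrix ι ι k) (R : (U ⊗[k] U)ˣ)
    (F : (U ⊗[k] (U ⊗[k] L))ˣ) (s : L →ₐ[k] A) (X : Matrix ι ι A) : A :=
  Matrix.trace ((ρ (drinfeldMu R)).map (algebraMap k A) * (repOne ρ (theta F)).map s * X *
    (repOne ρ (zeta F)).map s)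

/-- The matrix form of a representation `ρ` of `U` on `V` in a basis of `V`. -/
def matrixRep {V : Type*} [AddCommGroup V] [Module k V] (b : Module.Basis ι k V)
    (ρ : U →ₐ[k] Module.End k V) : U →ₐ[k] Matrix ι ι k :=
  (LinearMap.toMatrixAlgEquiv b).toAlgHom.comp ρ

end Trace

end DynRE

end

open scoped TensorProduct

set_option maxSynthPendingDepth 10

noncomputable section

namespace DynRE

/-! ### Counit and antipode calculus on tensor legs; the antipode and μ of a quasitriangular Hopf
algebra -/

section Hopf

variable {k U M : Type*} [Field k] [Ring U] [HopfAlgebra k U] [Ring M] [Algebra k M]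

local notation "γ" => HopfAlgebra.antipode k (A := U)

/-! Write E = End(V) and let A be the dRE algebra. The dynamical trace is unfolded into a trace with
one more leg. For X in E ⊗ A put D(X) = F X F⁻¹ in U ⊗ E ⊗ A (`dress`), the first leg of F staying
in U, and let τ(u ⊗ e ⊗ a) = tr(μ γ(u) e) a (`twistedTrace`). Then τ(D(X)) = Tr_d(X) by
`twistedTrace_dress`: γ(F₁)F₂ gives ϑ, while y μ = μ γ²(y) and cyclicity carry γ(F̄₁) around the
trace, where it becomes the γ⁻¹(F̄₁) of ζ.

The virtue of τ is that a factor x⁽¹⁾ ⊗ ρ(x⁽²⁾) ⊗ n, on either side of its argument, contributes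
only ε(x)n. On the left this is γ(x⁽¹⁾)x⁽²⁾ = ε(x); on the right it is x⁽²⁾ μ γ(x⁽¹⁾) = ε(x)μ, which
follows from R Δ = Δᵒᵖ R.

The smash product relations say that K, hence X = Kⁿ, commutes with the image of δ(l) in E ⊗ A
(`commute_coact_of_exchange`). Moreover (Δ ⊗ id)δ(l) commutes with F, by invariance of F and
quasi-commutativity of L. So it commutes with D(X), and τ turns this into commutation of s(l) with
τ(D(X)), where s is the map L → A.

For commutation with K, the cocycle identity gives (Δ ⊗ id)D(X) = F₁₍₂₃₎ (1 ⊗ D(X)) F₁₍₂₃₎⁻¹, whose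
trace over the last two Hopf legs is 1 ⊗ τ(D(X)). The same value arises from D(X) with its first leg
comultiplied, its two matrix legs flipped, and then conjugated by either R₂₁ or R⁻¹
(`twistedTrace_conj_comulRep`). The reflection equation says precisely that multiplying the
R₂₁-conjugate by the comultiplied D(K) on the left equals multiplying the R⁻¹-conjugate by it on the
right. Applying τ collapses that factor to K and leaves K(1 ⊗ τ(D(X))) = (1 ⊗ τ(D(X)))K
(`commute_generator_twistedTrace`). The entries of K and the image of L generate A. -/

@[simp] lemma counitFirst_tmul (x : U) (m : M) :
    counitFirst k U M (x ⊗ₜ[k] m) = Coalgebra.counit (R := k) x • m := by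
  simp [counitFirst]

@[simp] lemma onRight_tmul {N : Type*} [Ring N] [Algebra k N] (f : M →ₐ[k] N) (x : U) (m : M) :
    onRight U f (x ⊗ₜ[k] m) = x ⊗ₜ[k] f m := by
  simp [onRight]

lemma comulFirst_tmul (x : U) (m : M) :
    comulFirst k U M (x ⊗ₜ[k] m) =
      TensorProduct.assoc k U U M (Coalgebra.comul (R := k) x ⊗ₜ[k] m) := by
  simp only [comulFirst, AlgHom.comp_apply, Algebra.TensorProduct.map_tmul,
    Bialgebra.comulAlgHom_apply]
  rfl

lemma comulFirst_tmul_eq_sum (x : U) (m : M) :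
    comulFirst k U M (x ⊗ₜ[k] m) = ∑ i ∈ (Coalgebra.Repr.arbitrary k x).index,
      (Coalgebra.Repr.arbitrary k x).left i ⊗ₜ[k]
        ((Coalgebra.Repr.arbitrary k x).right i ⊗ₜ[k] m) := by
  rw [comulFirst_tmul, ← (Coalgebra.Repr.arbitrary k x).eq, TensorProduct.sum_tmul, map_sum]
  simp

/-- The map a ⊗ b ↦ γ(a)b evaluated on p₁₃q₂₃. Compared with its value on (Δ ⊗ id)R = R₁₃R₂₃, it
yields (γ ⊗ id)R = R⁻¹. -/
lemma antipode_rTensor_mul_eq (p q : U ⊗[k] M) :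
    LinearMap.rTensor M (LinearMap.mul' k U ∘ₗ (γ).rTensor U)
      ((TensorProduct.assoc k U U M).symm
        (onRight U (Algebra.TensorProduct.includeRight : M →ₐ[k] U ⊗[k] M) p * (1 ⊗ₜ[k] q))) =
      (γ).rTensor M p * q := by
  induction p with
  | zero => simp
  | add x y hx hy => simp only [map_add, add_mul, hx, hy]
  | tmul x m =>
    induction q with
    | zero => simp
    | add u v hu hv => simp only [map_add, mul_add, TensorProduct.tmul_add, hu, hv]
    | tmul y n => simp

lemma antipode_mul_comulFirst (g : U ⊗[k] M) :
    LinearMap.rTensor M (LinearMap.mul' k U ∘ₗ (γ).rTensor U)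
      ((TensorProduct.assoc k U U M).symm (comulFirst k U M g)) =
      1 ⊗ₜ[k] counitFirst k U M g := by
  induction g with
  | zero => simp
  | add x y hx hy => simp only [map_add, TensorProduct.tmul_add, hx, hy]
  | tmul x m =>
    rw [comulFirst_tmul, LinearEquiv.symm_apply_apply, LinearMap.rTensor_tmul,
      LinearMap.comp_apply, HopfAlgebra.mul_antipode_rTensor_comul_apply, counitFirst_tmul,
      Algebra.algebraMap_eq_smul_one, TensorProduct.smul_tmul]

lemma lTensor_mul_antipode_eq (p : M ⊗[k] U) (q : M ⊗[k] U) :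
    LinearMap.lTensor M (LinearMap.mul' k U ∘ₗ (γ).lTensor U)
      (Algebra.TensorProduct.map (AlgHom.id k M)
          (Algebra.TensorProduct.includeLeft : U →ₐ[k] U ⊗[k] U) p *
        Algebra.TensorProduct.map (AlgHom.id k M)
          (Algebra.TensorProduct.includeRight : U →ₐ[k] U ⊗[k] U) q) =
      p * (γ).lTensor M q := by
  induction p with
  | zero => simp
  | add x y hx hy => simp only [map_add, add_mul, hx, hy]
  | tmul m x =>
    induction q with
    | zero => simp
    | add u v hu hv => simp only [map_add, mul_add, hu, hv]
    | tmul n y => simp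

lemma lTensor_mul_antipode_comul (g : M ⊗[k] U) :
    LinearMap.lTensor M (LinearMap.mul' k U ∘ₗ (γ).lTensor U)
      (Algebra.TensorProduct.map (AlgHom.id k M) (Bialgebra.comulAlgHom k U) g) =
      Algebra.TensorProduct.map (AlgHom.id k M)
        ((Algebra.ofId k U).comp (Bialgebra.counitAlgHom k U)) g := by
  induction g with
  | zero => simp
  | add x y hx hy => simp only [map_add, hx, hy]
  | tmul m x =>
    simp [Algebra.ofId_apply]

lemma counitFirst_comulFirst (g : U ⊗[k] M) :
    counitFirst k U (U ⊗[k] M) (comulFirst k U M g) = g := by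
  induction g with
  | zero => simp
  | add x y hx hy => simp only [map_add, hx, hy]
  | tmul x m =>
    simp only [comulFirst_tmul_eq_sum, map_sum, counitFirst_tmul]
    simp only [TensorProduct.smul_tmul', ← TensorProduct.sum_tmul, Coalgebra.sum_counit_smul]

variable {R : (U ⊗[k] U)ˣ}

/-! ### R under the antipode, conjugation by μ, bijectivity of γ -/

namespace IsUniversalRMatrix

/-- Applying ε to the first leg of (Δ ⊗ id)R = R₁₃R₂₃ gives R = (1 ⊗ (ε ⊗ id)R) R, and R cancels. -/
lemma counitFirst_eq_one (hR : IsUniversalRMatrix R) :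
    counitFirst k U U (R : U ⊗[k] U) = 1 := by
  have h1 : ∀ g : U ⊗[k] U, counitFirst k U (U ⊗[k] U)
      (onRight U (Algebra.TensorProduct.includeRight : U →ₐ[k] U ⊗[k] U) g) =
        1 ⊗ₜ[k] counitFirst k U U g := by
    intro g
    induction g with
    | zero => simp
    | add x y hx hy => simp only [map_add, TensorProduct.tmul_add, hx, hy]
    | tmul x m => simp
  have h := congrArg (counitFirst k U (U ⊗[k] U)) hR.comul_left
  rw [counitFirst_comulFirst, map_mul, h1, counitFirst_tmul, Bialgebra.counit_one, one_smul] at h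
  have h2 : (1 : U) ⊗ₜ[k] counitFirst k U U (R : U ⊗[k] U) = 1 := by
    have := congrArg (· * ((R⁻¹ : (U ⊗[k] U)ˣ) : U ⊗[k] U)) h
    simpa [mul_assoc] using this.symm
  have h3 := congrArg (counitFirst k U U) h2
  simpa using h3

lemma antipode_rTensor (hR : IsUniversalRMatrix R) :
    (γ).rTensor U (R : U ⊗[k] U) = ((R⁻¹ : (U ⊗[k] U)ˣ) : U ⊗[k] U) := by
  have h := antipode_mul_comulFirst (R : U ⊗[k] U)
  rw [hR.comul_left, antipode_rTensor_mul_eq, hR.counitFirst_eq_one] at h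
  exact Units.eq_inv_of_mul_eq_one_right h

/-- Inverting (id ⊗ Δ)R = R₁₃R₁₂ gives (id ⊗ Δ)R⁻¹ = R̄₁₂R̄₁₃. Applying b ⊗ c ↦ bγ(c) to the last
two legs yields R⁻¹ · (id ⊗ γ)R⁻¹ = 1. -/
lemma antipode_lTensor_inv (hR : IsUniversalRMatrix R) :
    (γ).lTensor U ((R⁻¹ : (U ⊗[k] U)ˣ) : U ⊗[k] U) = (R : U ⊗[k] U) := by
  have hε : Algebra.TensorProduct.map (AlgHom.id k U)
        ((Algebra.ofId k U).comp (Bialgebra.counitAlgHom k U)) (R : U ⊗[k] U) = 1 := by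
    have h1 : ∀ g : U ⊗[k] U,
        onRight U ((Algebra.TensorProduct.lid k U).toAlgHom.comp
          (Algebra.TensorProduct.map (Bialgebra.counitAlgHom k U) (AlgHom.id k U)))
          (onRight U (Bialgebra.comulAlgHom k U) g) = g := by
      intro g
      induction g with
      | zero => simp
      | add x y hx hy => simp only [map_add, hx, hy]
      | tmul x y =>
        have : ((Algebra.TensorProduct.lid k U).toAlgHom.comp
          (Algebra.TensorProduct.map (Bialgebra.counitAlgHom k U) (AlgHom.id k U)))
            (Coalgebra.comul (R := k) y) = y := by
          rw [← (Coalgebra.Repr.arbitrary k y).eq, map_sum]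
          simp [Coalgebra.sum_counit_smul]
        simp only [onRight_tmul, Bialgebra.comulAlgHom_apply, this]
    have h2 : ∀ g : U ⊗[k] U,
        onRight U ((Algebra.TensorProduct.lid k U).toAlgHom.comp
          (Algebra.TensorProduct.map (Bialgebra.counitAlgHom k U) (AlgHom.id k U)))
          (onRight U (Algebra.TensorProduct.includeRight : U →ₐ[k] U ⊗[k] U) g) = g := by
      intro g
      induction g with
      | zero => simp
      | add x y hx hy => simp only [map_add, hx, hy]
      | tmul x y => simp
    have h3 : ∀ g : U ⊗[k] U,
        onRight U ((Algebra.TensorProduct.lid k U).toAlgHom.comp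
          (Algebra.TensorProduct.map (Bialgebra.counitAlgHom k U) (AlgHom.id k U)))
          (onRight U (Algebra.TensorProduct.includeLeft : U →ₐ[k] U ⊗[k] U) g) =
        Algebra.TensorProduct.map (AlgHom.id k U)
          ((Algebra.ofId k U).comp (Bialgebra.counitAlgHom k U)) g := by
      intro g
      induction g with
      | zero => simp
      | add x y hx hy => simp only [map_add, hx, hy]
      | tmul x y => simp [Algebra.ofId_apply, Algebra.algebraMap_eq_smul_one]
    have h := congrArg (onRight U ((Algebra.TensorProduct.lid k U).toAlgHom.comp
          (Algebra.TensorProduct.map (Bialgebra.counitAlgHom k U) (AlgHom.id k U)))) hR.comul_right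
    rw [map_mul, h1, h2, h3] at h
    have := congrArg (((R⁻¹ : (U ⊗[k] U)ˣ) : U ⊗[k] U) * ·) h
    simpa [← mul_assoc] using this.symm
  have hc : onRight U (Bialgebra.comulAlgHom k U) ((R⁻¹ : (U ⊗[k] U)ˣ) : U ⊗[k] U) =
      onRight U (Algebra.TensorProduct.includeLeft : U →ₐ[k] U ⊗[k] U)
          ((R⁻¹ : (U ⊗[k] U)ˣ) : U ⊗[k] U) *
        onRight U (Algebra.TensorProduct.includeRight : U →ₐ[k] U ⊗[k] U)
          ((R⁻¹ : (U ⊗[k] U)ˣ) : U ⊗[k] U) := by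
    have h : Units.map (onRight U (Bialgebra.comulAlgHom k U)).toMonoidHom R =
        Units.map (onRight U
          (Algebra.TensorProduct.includeRight : U →ₐ[k] U ⊗[k] U)).toMonoidHom R *
        Units.map (onRight U
          (Algebra.TensorProduct.includeLeft : U →ₐ[k] U ⊗[k] U)).toMonoidHom R :=
      Units.ext hR.comul_right
    have h' := congrArg (fun u : (U ⊗[k] (U ⊗[k] U))ˣ => ((u⁻¹ : _ˣ) : U ⊗[k] (U ⊗[k] U))) h
    simpa [mul_inv_rev, ← map_inv] using h'
  have h := lTensor_mul_antipode_comul ((R⁻¹ : (U ⊗[k] U)ˣ) : U ⊗[k] U)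
  have hε' : Algebra.TensorProduct.map (AlgHom.id k U)
        ((Algebra.ofId k U).comp (Bialgebra.counitAlgHom k U))
        ((R⁻¹ : (U ⊗[k] U)ˣ) : U ⊗[k] U) = 1 := by
    have h1 : Units.map (Algebra.TensorProduct.map (AlgHom.id k U)
        ((Algebra.ofId k U).comp (Bialgebra.counitAlgHom k U))).toMonoidHom R = 1 := Units.ext hε
    have h2 := congrArg (fun u : (U ⊗[k] U)ˣ => ((u⁻¹ : _ˣ) : U ⊗[k] U)) h1
    simpa [← map_inv] using h2
  rw [hε', show Algebra.TensorProduct.map (AlgHom.id k U) (Bialgebra.comulAlgHom k U) =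
    onRight U (Bialgebra.comulAlgHom k U) from rfl, hc] at h
  have h3 := (lTensor_mul_antipode_eq (k := k) ((R⁻¹ : (U ⊗[k] U)ˣ) : U ⊗[k] U)
    ((R⁻¹ : (U ⊗[k] U)ˣ) : U ⊗[k] U)).symm.trans h
  have := congrArg ((R : U ⊗[k] U) * ·) h3
  simpa [← mul_assoc] using this

/-- `x⁽²⁾ μ γ(x⁽¹⁾) = ε(x) μ` -/
lemma comul_mul_drinfeldMu_mul_antipode (hR : IsUniversalRMatrix R) (x : U) :
    (LinearMap.mul' k U ∘ₗ TensorProduct.map (LinearMap.mulRight k (drinfeldMu R)) (γ) ∘ₗ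
      (TensorProduct.comm k U U).toLinearMap) (Coalgebra.comul (R := k) x) =
      Coalgebra.counit (R := k) x • drinfeldMu R := by
  have key1 : ∀ t r : U ⊗[k] U, LinearMap.mul' k U ((γ).lTensor U
      (TensorProduct.comm k U U t * r)) =
      (LinearMap.mul' k U ∘ₗ
        TensorProduct.map (LinearMap.mulRight k (LinearMap.mul' k U ((γ).lTensor U r))) (γ) ∘ₗ
        (TensorProduct.comm k U U).toLinearMap) t := by
    intro t r
    induction t with
    | zero => simp
    | add x y hx hy => simp only [map_add, add_mul, hx, hy]
    | tmul a b =>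
      induction r with
      | zero => simp
      | add u v hu hv =>
        rw [mul_add, map_add, map_add, hu, hv]
        simp [mul_add, add_mul]
      | tmul c d => simp [HopfAlgebra.antipode_mul_antidistrib, mul_assoc]
  have key2 : ∀ t r : U ⊗[k] U, LinearMap.mul' k U ((γ).lTensor U (r * t)) =
      LinearMap.mul' k U (TensorProduct.map
        (LinearMap.mulRight k (LinearMap.mul' k U ((γ).lTensor U t))) (γ) r) := by
    intro t r
    induction r with
    | zero => simp
    | add x y hx hy => simp only [map_add, add_mul, hx, hy]
    | tmul a b =>
      induction t with
      | zero => simp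
      | add u v hu hv =>
        simp only [map_add, mul_add, hu, hv, TensorProduct.map_tmul, LinearMap.mulRight_apply,
          LinearMap.mul'_apply, add_mul]
      | tmul c d => simp [HopfAlgebra.antipode_mul_antidistrib, mul_assoc]
  -- Apply a ⊗ b ↦ aγ(b) to R Δ(x) = Δᵒᵖ(x) R: one side is R₁x⁽¹⁾γ(x⁽²⁾)γ(R₂) = ε(x)μ, the other is
  -- x⁽²⁾μγ(x⁽¹⁾).
  have h := congrArg (fun t => LinearMap.mul' k U ((γ).lTensor U t)) (hR.intertwines x)
  simp only [key1] at h
  rw [key2, HopfAlgebra.mul_antipode_lTensor_comul_apply] at h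
  rw [drinfeldMu, ← h]
  generalize (R : U ⊗[k] U) = r
  induction r with
  | zero => simp
  | add x y hx hy => simp only [map_add, smul_add, hx, hy]
  | tmul a b => simp [Algebra.algebraMap_eq_smul_one]

/-- Evaluate y⁽³⁾ μ γ(y⁽²⁾) γ²(y⁽¹⁾) in two ways. Since γ(y⁽²⁾)γ²(y⁽¹⁾) = γ(γ(y⁽¹⁾)y⁽²⁾), it is yμ;
contracting y⁽³⁾ μ γ(y⁽²⁾) first gives μγ²(y). -/
lemma mul_drinfeldMu (hR : IsUniversalRMatrix R) (y : U) :
    y * drinfeldMu R = drinfeldMu R * (γ) ((γ) y) := by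
  -- `a ⊗ b ⊗ c ↦ c μ γ(b) γ²(a)`
  set T : U ⊗[k] U →ₗ[k] U := LinearMap.mul' k U ∘ₗ
    TensorProduct.map (LinearMap.mulRight k (drinfeldMu R)) (γ) ∘ₗ
      (TensorProduct.comm k U U).toLinearMap with hT
  have hTt : ∀ a b : U, T (a ⊗ₜ[k] b) = b * drinfeldMu R * (γ) a := fun a b => by simp [hT]
  set G : U ⊗[k] (U ⊗[k] U) →ₗ[k] U := LinearMap.mul' k U ∘ₗ
    TensorProduct.map T ((γ) ∘ₗ (γ)) ∘ₗ (TensorProduct.comm k U (U ⊗[k] U)).toLinearMap with hG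
  have hGt : ∀ (a : U) (t : U ⊗[k] U), G (a ⊗ₜ[k] t) = T t * (γ) ((γ) a) := fun a t => by
    simp [hG]
  have h := congrArg G (Coalgebra.coassoc_apply (R := k) y)
  have h1 : ∀ t : U ⊗[k] U, G (TensorProduct.assoc k U U U
      ((Coalgebra.comul (R := k)).rTensor U t)) =
      TensorProduct.lid k U ((Coalgebra.counit (R := k) (A := U)).rTensor U t) *
        drinfeldMu R := by
    intro t
    induction t with
    | zero => simp
    | add x y hx hy => simp only [map_add, add_mul, hx, hy]
    | tmul a c =>
      have h2 : ∀ s : U ⊗[k] U, G (TensorProduct.assoc k U U U (s ⊗ₜ[k] c)) =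
          c * drinfeldMu R * (γ) (LinearMap.mul' k U ((γ).rTensor U s)) := by
        intro s
        induction s with
        | zero => simp
        | add x y hx hy => simp only [map_add, TensorProduct.add_tmul, mul_add, hx, hy]
        | tmul u v =>
          simp [hGt, hTt, HopfAlgebra.antipode_mul_antidistrib, mul_assoc]
      rw [LinearMap.rTensor_tmul, h2, HopfAlgebra.mul_antipode_rTensor_comul_apply]
      simp [Algebra.algebraMap_eq_smul_one]
  have h3 : ∀ t : U ⊗[k] U, G ((Coalgebra.comul (R := k)).lTensor U t) =
      drinfeldMu R * (γ) ((γ) (TensorProduct.rid k U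
        ((Coalgebra.counit (R := k) (A := U)).lTensor U t))) := by
    intro t
    induction t with
    | zero => simp
    | add x y hx hy => simp only [map_add, mul_add, hx, hy]
    | tmul a c =>
      rw [LinearMap.lTensor_tmul, hGt, hT, hR.comul_mul_drinfeldMu_mul_antipode]
      simp
  rw [h1, h3, Coalgebra.rTensor_counit_comul, Coalgebra.lTensor_counit_comul] at h
  simpa using h

/-- Once μ is invertible, y μ = μ γ²(y) makes γ² an inner automorphism, so γ is bijective. Nothing
about γ⁻¹ is used to invert μ. -/
lemma antipode_bijective (hR : IsUniversalRMatrix R) : Function.Bijective (γ) := by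
  obtain ⟨ν, hν⟩ : ∃ ν, drinfeldMu R * ν = 1 := by
    -- The right inverse is γ²(R̄₁)γ(R̄₂): moving γ²(R̄₁) to the left across μ gives a ⊗ b ↦ aγ(b)
    -- evaluated on R⁻¹R.
    refine ⟨LinearMap.mul' k U (TensorProduct.map ((γ) ∘ₗ (γ)) (γ)
      ((R⁻¹ : (U ⊗[k] U)ˣ) : U ⊗[k] U)), ?_⟩
    have h1 : ∀ t : U ⊗[k] U, drinfeldMu R * LinearMap.mul' k U
        (TensorProduct.map ((γ) ∘ₗ (γ)) (γ) t) =
        LinearMap.mul' k U ((γ).lTensor U (t * (R : U ⊗[k] U))) := by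
      intro t
      induction t with
      | zero => simp
      | add x y hx hy => simp only [map_add, mul_add, add_mul, hx, hy]
      | tmul a b =>
        simp only [TensorProduct.map_tmul, LinearMap.mul'_apply, LinearMap.comp_apply]
        rw [← mul_assoc, ← hR.mul_drinfeldMu, drinfeldMu]
        generalize (R : U ⊗[k] U) = r
        induction r with
        | zero => simp
        | add x y hx hy => simp only [map_add, mul_add, add_mul, hx, hy]
        | tmul c d => simp [HopfAlgebra.antipode_mul_antidistrib, mul_assoc]
    rw [h1]
    simp [Algebra.TensorProduct.one_def]
  obtain ⟨ν', hν'⟩ : ∃ ν', ν' * drinfeldMu R = 1 := by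
    -- The left inverse is γ(R̄₁)R̄₂: moving R̄₂ to the right across μ gives the same map on (γ ⊗
    -- γ)(R⁻¹) · R, and (γ ⊗ γ)(R⁻¹) = (γ ⊗ id)R = R⁻¹.
    refine ⟨LinearMap.mul' k U (((γ).rTensor U ((R⁻¹ : (U ⊗[k] U)ˣ) : U ⊗[k] U))), ?_⟩
    have h1 : ∀ t : U ⊗[k] U, LinearMap.mul' k U ((γ).rTensor U t) * drinfeldMu R =
        LinearMap.mul' k U ((γ).lTensor U
          (TensorProduct.map (γ) (γ) t * (R : U ⊗[k] U))) := by
      intro t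
      induction t with
      | zero => simp
      | add x y hx hy => simp only [map_add, add_mul, hx, hy]
      | tmul a b =>
        simp only [TensorProduct.map_tmul, LinearMap.mul'_apply, LinearMap.rTensor_tmul]
        rw [mul_assoc, hR.mul_drinfeldMu, drinfeldMu]
        generalize (R : U ⊗[k] U) = r
        induction r with
        | zero => simp
        | add x y hx hy => simp only [map_add, mul_add, add_mul, hx, hy]
        | tmul c d => simp [HopfAlgebra.antipode_mul_antidistrib, mul_assoc]
    rw [h1, ← LinearMap.rTensor_comp_lTensor, LinearMap.comp_apply, hR.antipode_lTensor_inv,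
      hR.antipode_rTensor]
    simp [Algebra.TensorProduct.one_def]
  have hνν : ν' = ν := left_inv_eq_right_inv hν' hν
  subst hνν
  have h2 : Function.Bijective ((γ) ∘ (γ)) := by
    refine ⟨fun x y hxy => ?_, fun z => ⟨drinfeldMu R * z * ν', ?_⟩⟩
    · have : x * drinfeldMu R = y * drinfeldMu R := by
        rw [hR.mul_drinfeldMu, hR.mul_drinfeldMu]
        exact congrArg _ hxy
      simpa [mul_assoc, hν] using congrArg (· * ν') this
    · have := hR.mul_drinfeldMu (drinfeldMu R * z * ν')
      rw [mul_assoc, hν', mul_one] at this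
      have h3 := congrArg (ν' * ·) this
      simp only [← mul_assoc, hν', one_mul] at h3
      exact h3.symm
  exact ⟨h2.1.of_comp, h2.2.of_comp⟩

end IsUniversalRMatrix

end Hopf

/-! ### The twisted trace τ and its invariance under comultiplied factors -/

section TwistedTrace

variable {k U E N A : Type*} [Field k] [Ring U] [HopfAlgebra k U] [Ring E] [Algebra k E]
  [Ring N] [Algebra k N] [Ring A] [Algebra k A]

local notation "γ" => HopfAlgebra.antipode k (A := U)

/-- The functional `u ⊗ e ⊗ n ↦ tr(m γ(u) e) n`. -/
def twistedTrace (tr : E →ₗ[k] k) (ρ : U →ₐ[k] E) (m : U) (N : Type*) [Ring N] [Algebra k N] :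
    U ⊗[k] (E ⊗[k] N) →ₗ[k] N :=
  (TensorProduct.lid k N).toLinearMap ∘ₗ (tr ∘ₗ LinearMap.mul' k E).rTensor N ∘ₗ
    (TensorProduct.assoc k E E N).symm.toLinearMap ∘ₗ
    (ρ.toLinearMap ∘ₗ LinearMap.mulLeft k m ∘ₗ HopfAlgebra.antipode k (A := U)).rTensor (E ⊗[k] N)

@[simp] lemma twistedTrace_tmul (tr : E →ₗ[k] k) (ρ : U →ₐ[k] E) (m u : U) (e : E) (n : N) :
    twistedTrace tr ρ m N (u ⊗ₜ[k] (e ⊗ₜ[k] n)) = tr (ρ m * ρ ((γ) u) * e) • n := by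
  simp [twistedTrace]

/-- `x ⊗ n ↦ x⁽¹⁾ ⊗ ρ(x⁽²⁾) ⊗ n`. -/
def comulRep (ρ : U →ₐ[k] E) (N : Type*) [Ring N] [Algebra k N] :
    U ⊗[k] N →ₐ[k] U ⊗[k] (E ⊗[k] N) :=
  (onRight U (Algebra.TensorProduct.map ρ (AlgHom.id k N))).comp (comulFirst k U N)

lemma comulRep_tmul (ρ : U →ₐ[k] E) (x : U) (n : N) :
    comulRep ρ N (x ⊗ₜ[k] n) = onRight U (Algebra.TensorProduct.map ρ (AlgHom.id k N))
      (TensorProduct.assoc k U U N (Coalgebra.comul (R := k) x ⊗ₜ[k] n)) := by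
  rw [comulRep, AlgHom.comp_apply, comulFirst_tmul]

/-- `m` satisfies `x⁽²⁾ m γ(x⁽¹⁾) = ε(x) m`. -/
def IsTwistingElement (k : Type*) {U : Type*} [Field k] [Ring U] [HopfAlgebra k U] (m : U) : Prop :=
  ∀ x : U, (LinearMap.mul' k U ∘ₗ
    TensorProduct.map (LinearMap.mulRight k m) (HopfAlgebra.antipode k) ∘ₗ
      (TensorProduct.comm k U U).toLinearMap) (Coalgebra.comul (R := k) x) =
      Coalgebra.counit (R := k) x • m

/-- In tr(m γ(x⁽¹⁾u) x⁽²⁾ e) the antipode puts γ(x⁽¹⁾) next to x⁽²⁾. No property of m or of tr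
enters on this side. -/
lemma twistedTrace_comulRep_mul (tr : E →ₗ[k] k) (ρ : U →ₐ[k] E) (m : U)
    (θ : U ⊗[k] N) (P : U ⊗[k] (E ⊗[k] N)) :
    twistedTrace tr ρ m N (comulRep ρ N θ * P) =
      counitFirst k U N θ * twistedTrace tr ρ m N P := by
  induction P with
  | zero => simp
  | add x y hx hy => simp only [map_add, mul_add, hx, hy]
  | tmul u P =>
  induction P with
  | zero => simp
  | add x y hx hy => simp only [map_add, mul_add, TensorProduct.tmul_add, hx, hy]
  | tmul e n' =>
  induction θ with
  | zero => simp
  | add x y hx hy => simp only [map_add, add_mul, hx, hy]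
  | tmul x n =>
    have key : ∀ s : U ⊗[k] U, twistedTrace tr ρ m N
        (onRight U (Algebra.TensorProduct.map ρ (AlgHom.id k N))
          (TensorProduct.assoc k U U N (s ⊗ₜ[k] n)) * (u ⊗ₜ[k] (e ⊗ₜ[k] n'))) =
        tr (ρ m * ρ ((γ) u) * ρ (LinearMap.mul' k U ((γ).rTensor U s)) * e) • (n * n') := by
      intro s
      induction s with
      | zero => simp
      | add x y hx hy =>
        simp only [map_add, TensorProduct.add_tmul, add_mul, mul_add, add_smul, hx, hy]
      | tmul a b => simp [HopfAlgebra.antipode_mul_antidistrib, mul_assoc]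
    rw [comulRep_tmul, key, HopfAlgebra.mul_antipode_rTensor_comul_apply]
    simp [Algebra.algebraMap_eq_smul_one, smul_smul, mul_comm]

/-- Cyclicity turns tr(m γ(u x⁽¹⁾) e x⁽²⁾) into tr(x⁽²⁾ m γ(x⁽¹⁾) γ(u) e), where the twisting
property of m applies. -/
lemma twistedTrace_mul_comulRep {tr : E →ₗ[k] k} (htr : ∀ x y, tr (x * y) = tr (y * x))
    (ρ : U →ₐ[k] E) {m : U} (hm : IsTwistingElement k m)
    (θ : U ⊗[k] N) (P : U ⊗[k] (E ⊗[k] N)) :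
    twistedTrace tr ρ m N (P * comulRep ρ N θ) =
      twistedTrace tr ρ m N P * counitFirst k U N θ := by
  induction P with
  | zero => simp
  | add x y hx hy => simp only [map_add, add_mul, hx, hy]
  | tmul u P =>
  induction P with
  | zero => simp
  | add x y hx hy => simp only [map_add, add_mul, TensorProduct.tmul_add, hx, hy]
  | tmul e n' =>
  induction θ with
  | zero => simp
  | add x y hx hy => simp only [map_add, mul_add, hx, hy]
  | tmul x n =>
    have key : ∀ s : U ⊗[k] U, twistedTrace tr ρ m N
        ((u ⊗ₜ[k] (e ⊗ₜ[k] n')) * onRight U (Algebra.TensorProduct.map ρ (AlgHom.id k N))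
          (TensorProduct.assoc k U U N (s ⊗ₜ[k] n))) =
        tr (ρ ((LinearMap.mul' k U ∘ₗ TensorProduct.map (LinearMap.mulRight k m) (γ) ∘ₗ
          (TensorProduct.comm k U U).toLinearMap) s) * ρ ((γ) u) * e) • (n' * n) := by
      intro s
      induction s with
      | zero => simp
      | add x y hx hy =>
        simp only [map_add, TensorProduct.add_tmul, add_mul, mul_add, add_smul, hx, hy]
      | tmul a b =>
        simp only [TensorProduct.assoc_tmul, onRight_tmul, Algebra.TensorProduct.map_tmul,
          Algebra.TensorProduct.tmul_mul_tmul, twistedTrace_tmul, AlgHom.coe_id, id_eq,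
          HopfAlgebra.antipode_mul_antidistrib, map_mul, LinearMap.comp_apply,
          LinearEquiv.coe_coe, TensorProduct.comm_tmul, TensorProduct.map_tmul,
          LinearMap.mulRight_apply, LinearMap.mul'_apply]
        congr 1
        rw [← mul_assoc, htr]
        simp only [mul_assoc]
    rw [comulRep_tmul, key, hm x]
    simp [smul_smul]

/-- `u ⊗ P ↦ ρ(u) ⊗ τ(P)`, with the functional `τ` of `twistedTrace`. -/
def repTwistedTrace (tr : E →ₗ[k] k) (ρ : U →ₐ[k] E) (m : U) (N : Type*) [Ring N] [Algebra k N] :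
    U ⊗[k] (U ⊗[k] (E ⊗[k] N)) →ₗ[k] E ⊗[k] N :=
  TensorProduct.map ρ.toLinearMap (twistedTrace tr ρ m N)

@[simp] lemma repTwistedTrace_tmul (tr : E →ₗ[k] k) (ρ : U →ₐ[k] E) (m u : U)
    (P : U ⊗[k] (E ⊗[k] N)) :
    repTwistedTrace tr ρ m N (u ⊗ₜ[k] P) = ρ u ⊗ₜ[k] twistedTrace tr ρ m N P := by
  simp [repTwistedTrace]

lemma repTwistedTrace_onRight_comulRep_mul (tr : E →ₗ[k] k) (ρ : U →ₐ[k] E) (m : U)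
    (φ : U ⊗[k] (U ⊗[k] N)) (P : U ⊗[k] (U ⊗[k] (E ⊗[k] N))) :
    repTwistedTrace tr ρ m N (onRight U (comulRep ρ N) φ * P) =
      Algebra.TensorProduct.map ρ (AlgHom.id k N) (onRight U (counitFirst k U N) φ) *
        repTwistedTrace tr ρ m N P := by
  induction φ with
  | zero => simp
  | add x y hx hy => simp only [map_add, add_mul, hx, hy]
  | tmul x θ =>
    induction P with
    | zero => simp
    | add x y hx hy => simp only [map_add, mul_add, hx, hy]
    | tmul u P =>
      simp [twistedTrace_comulRep_mul]

lemma repTwistedTrace_mul_onRight_comulRep {tr : E →ₗ[k] k} (htr : ∀ x y, tr (x * y) = tr (y * x))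
    (ρ : U →ₐ[k] E) {m : U} (hm : IsTwistingElement k m)
    (φ : U ⊗[k] (U ⊗[k] N)) (P : U ⊗[k] (U ⊗[k] (E ⊗[k] N))) :
    repTwistedTrace tr ρ m N (P * onRight U (comulRep ρ N) φ) =
      repTwistedTrace tr ρ m N P *
        Algebra.TensorProduct.map ρ (AlgHom.id k N) (onRight U (counitFirst k U N) φ) := by
  induction φ with
  | zero => simp
  | add x y hx hy => simp only [map_add, mul_add, hx, hy]
  | tmul x θ =>
    induction P with
    | zero => simp
    | add x y hx hy => simp only [map_add, add_mul, hx, hy]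
    | tmul u P =>
      simp [twistedTrace_mul_comulRep htr ρ hm]

/-- `(ρ ⊗ ρ)(x) ⊗ 1`. -/
def repConst (ρ : U →ₐ[k] E) (A : Type*) [Ring A] [Algebra k A] :
    U ⊗[k] U →ₐ[k] E ⊗[k] (E ⊗[k] A) :=
  Algebra.TensorProduct.map ρ (Algebra.TensorProduct.includeLeft.comp ρ)

@[simp] lemma repConst_tmul (ρ : U →ₐ[k] E) (x y : U) :
    repConst ρ A (x ⊗ₜ[k] y) = ρ x ⊗ₜ[k] (ρ y ⊗ₜ[k] 1) := by
  simp [repConst]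

/-- A matrix factor γ(p) left of e is absorbed into the antipode, γ(w)γ(p) = γ(pw). A factor r right
of e goes around the trace and across m as γ²(r), so it is absorbed as γ(r). Both outer factors thus
act on w itself. -/
lemma twistedTrace_conj_leftComm {tr : E →ₗ[k] k} (htr : ∀ x y, tr (x * y) = tr (y * x))
    (ρ : U →ₐ[k] E) {m : U} (hm : ∀ y, y * m = m * (γ) ((γ) y)) (P w P' : U ⊗[k] U)
    (e : E) (a : A) :
    twistedTrace tr ρ m (E ⊗[k] A)
      ((1 ⊗ₜ[k] repConst ρ A ((γ).rTensor U P)) *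
        onRight U (Algebra.TensorProduct.leftComm k E E A).toAlgHom
          (onRight U (Algebra.TensorProduct.map ρ (AlgHom.id k (E ⊗[k] A)))
            (TensorProduct.assoc k U U (E ⊗[k] A) (w ⊗ₜ[k] (e ⊗ₜ[k] a)))) *
        (1 ⊗ₜ[k] repConst ρ A P')) =
      repTwistedTrace tr ρ m A (TensorProduct.assoc k U U (E ⊗[k] A)
        (TensorProduct.comm k U U (P * w * (γ).rTensor U P') ⊗ₜ[k] (e ⊗ₜ[k] a))) := by
  induction P with
  | zero => simp
  | add x y hx hy =>
    simp only [map_add, add_mul, TensorProduct.tmul_add, TensorProduct.add_tmul, hx, hy]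
  | tmul p p' =>
  induction w with
  | zero => simp
  | add x y hx hy =>
    simp only [map_add, mul_add, add_mul, TensorProduct.add_tmul, hx, hy]
  | tmul w w' =>
  induction P' with
  | zero => simp
  | add x y hx hy =>
    simp only [map_add, mul_add, TensorProduct.tmul_add, TensorProduct.add_tmul, hx, hy]
  | tmul r r' =>
    have h : tr (ρ m * ρ ((γ) w) * (ρ ((γ) p) * e * ρ r)) =
        tr (ρ m * ρ ((γ) (p * w * (γ) r)) * e) := by
      rw [← mul_assoc, htr, ← mul_assoc, ← mul_assoc (ρ r), ← map_mul ρ r m, hm r]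
      simp only [HopfAlgebra.antipode_mul_antidistrib, map_mul, mul_assoc]
    simp [h, -TensorProduct.tmul_smul, ← TensorProduct.tmul_smul]

/-- Under the trace, the outer conjugation becomes Q'Δ(x)Q = Δᵒᵖ(x), which undoes the exchange of
legs. It is applied with (Q, Q') = (R₂₁, R₂₁⁻¹) and (R⁻¹, R); that both choices give the same
right-hand side drives the proof of centrality. -/
lemma twistedTrace_conj_comulRep {tr : E →ₗ[k] k} (htr : ∀ x y, tr (x * y) = tr (y * x))
    (ρ : U →ₐ[k] E) {m : U} (hm : ∀ y, y * m = m * (γ) ((γ) y)) {Q Q' : U ⊗[k] U}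
    (hγ : (γ).rTensor U Q' = Q)
    (hΔ : ∀ x : U, Q' * Coalgebra.comul x * Q = TensorProduct.comm k U U (Coalgebra.comul x))
    (θ : U ⊗[k] (E ⊗[k] A)) :
    twistedTrace tr ρ m (E ⊗[k] A)
      ((1 ⊗ₜ[k] repConst ρ A Q) *
        onRight U (Algebra.TensorProduct.leftComm k E E A).toAlgHom (comulRep ρ (E ⊗[k] A) θ) *
        (1 ⊗ₜ[k] repConst ρ A Q')) =
      repTwistedTrace tr ρ m A (comulFirst k U (E ⊗[k] A) θ) := by
  induction θ with
  | zero => simp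
  | add x y hx hy => simp only [map_add, mul_add, add_mul, hx, hy]
  | tmul x n =>
  induction n with
  | zero => simp
  | add x y hx hy => simp only [map_add, mul_add, add_mul, TensorProduct.tmul_add, hx, hy]
  | tmul e a =>
    have h := twistedTrace_conj_leftComm htr ρ hm Q' (Coalgebra.comul x) Q' e a
    rw [hγ, hΔ, TensorProduct.comm_comm] at h
    rw [comulRep_tmul, comulFirst_tmul, h]

end TwistedTrace

/-! ### The coaction of the base algebra and the twist -/

section Base

variable {k H U E L A : Type*} [Field k] [Ring H] [HopfAlgebra k H] [Ring U] [HopfAlgebra k U]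
  [Ring E] [Algebra k E] [Ring L] [Algebra k L] [Ring A] [Algebra k A]

lemma comulFirst_coactU (j : H →ₐc[k] U) (B : BaseAlgebra k H L) (l : L) :
    comulFirst k U L (coactU j B l) = onRight U (coactU j B) (coactU j B l) := by
  have h1 : ∀ t : H ⊗[k] L, comulFirst k U L
      (Algebra.TensorProduct.map (j : H →ₐ[k] U) (AlgHom.id k L) t) =
      Algebra.TensorProduct.map (j : H →ₐ[k] U)
        (Algebra.TensorProduct.map (j : H →ₐ[k] U) (AlgHom.id k L))
        (TensorProduct.assoc k H H L ((Coalgebra.comul (R := k) (A := H)).rTensor L t)) := by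
    intro t
    induction t with
    | zero => simp
    | add x y hx hy => simp only [map_add, hx, hy]
    | tmul h m =>
      have h2 : ∀ s : H ⊗[k] H, TensorProduct.assoc k U U L
          (TensorProduct.map (j : H →ₗ[k] U) (j : H →ₗ[k] U) s ⊗ₜ[k] m) =
          Algebra.TensorProduct.map (j : H →ₐ[k] U)
            (Algebra.TensorProduct.map (j : H →ₐ[k] U) (AlgHom.id k L))
            (TensorProduct.assoc k H H L (s ⊗ₜ[k] m)) := by
        intro s
        induction s with
        | zero => simp
        | add x y hx hy => simp only [map_add, TensorProduct.add_tmul, hx, hy]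
        | tmul x y => simp
      rw [Algebra.TensorProduct.map_tmul, comulFirst_tmul, LinearMap.rTensor_tmul, ← h2]
      congr 2
      exact (CoalgHomClass.map_comp_comul_apply j h).symm
  have h3 : ∀ t : H ⊗[k] L, onRight U (coactU j B)
      (Algebra.TensorProduct.map (j : H →ₐ[k] U) (AlgHom.id k L) t) =
      Algebra.TensorProduct.map (j : H →ₐ[k] U)
        (Algebra.TensorProduct.map (j : H →ₐ[k] U) (AlgHom.id k L))
        (B.coact.toLinearMap.lTensor H t) := by
    intro t
    induction t with
    | zero => simp
    | add x y hx hy => simp only [map_add, hx, hy]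
    | tmul h m => simp [coactU]
  change comulFirst k U L (Algebra.TensorProduct.map (j : H →ₐ[k] U) (AlgHom.id k L) (B.coact l)) =
    onRight U (coactU j B)
      (Algebra.TensorProduct.map (j : H →ₐ[k] U) (AlgHom.id k L) (B.coact l))
  rw [h1, h3, B.coact_coassoc]

lemma counitFirst_coactU (j : H →ₐc[k] U) (B : BaseAlgebra k H L) (l : L) :
    counitFirst k U L (coactU j B l) = l := by
  have h1 : ∀ t : H ⊗[k] L, counitFirst k U L
      (Algebra.TensorProduct.map (j : H →ₐ[k] U) (AlgHom.id k L) t) =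
      TensorProduct.lid k L ((Coalgebra.counit (R := k) (A := H)).rTensor L t) := by
    intro t
    induction t with
    | zero => simp
    | add x y hx hy => simp only [map_add, hx, hy]
    | tmul h m =>
      simp
  change counitFirst k U L
    (Algebra.TensorProduct.map (j : H →ₐ[k] U) (AlgHom.id k L) (B.coact l)) = l
  rw [h1, B.coact_counit]
  simp

/-- `h ⊗ l ↦ (F₁ ⊗ F₂ ⊗ (h ▹ F_L)) (1 ⊗ 1 ⊗ l)`. -/
def actOnBaseMul (B : BaseAlgebra k H L) (F : U ⊗[k] (U ⊗[k] L)) :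
    H ⊗[k] L →ₗ[k] U ⊗[k] (U ⊗[k] L) :=
  LinearMap.mul' k (U ⊗[k] (U ⊗[k] L)) ∘ₗ TensorProduct.map (actOnBase B F)
    (TensorProduct.mk k U (U ⊗[k] L) 1 ∘ₗ TensorProduct.mk k U L 1)

@[simp] lemma actOnBaseMul_tmul (B : BaseAlgebra k H L) (F : U ⊗[k] (U ⊗[k] L)) (h : H) (l : L) :
    actOnBaseMul B F (h ⊗ₜ[k] l) = actOnBase B F h * (1 ⊗ₜ[k] (1 ⊗ₜ[k] l)) := by
  simp [actOnBaseMul]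

@[simp] lemma actOnBase_tmul (B : BaseAlgebra k H L) (u v : U) (m : L) (h : H) :
    actOnBase B (u ⊗ₜ[k] (v ⊗ₜ[k] m)) h = u ⊗ₜ[k] (v ⊗ₜ[k] B.act h m) := by
  simp [actOnBase]

lemma actOnBase_add (B : BaseAlgebra k H L) (F G : U ⊗[k] (U ⊗[k] L)) :
    actOnBase B (F + G) = actOnBase B F + actOnBase B G := by
  ext h
  simp [actOnBase]

lemma actOnBase_zero (B : BaseAlgebra k H L) :
    actOnBase B (0 : U ⊗[k] (U ⊗[k] L)) = 0 := by
  ext h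
  simp [actOnBase]

/-- Quasi-commutativity of L, applied in the last leg of F. -/
lemma base_mul_eq_actOnBaseMul (B : BaseAlgebra k H L) (F : U ⊗[k] (U ⊗[k] L)) (l : L) :
    ((1 : U) ⊗ₜ[k] ((1 : U) ⊗ₜ[k] l)) * F = actOnBaseMul B F (B.coact l) := by
  have hadd : ∀ F G : U ⊗[k] (U ⊗[k] L), actOnBaseMul B (F + G) =
      actOnBaseMul B F + actOnBaseMul B G := by
    intro F G
    ext h m
    simp [actOnBase_add, add_mul]
  have hzero : actOnBaseMul B (0 : U ⊗[k] (U ⊗[k] L)) = 0 := by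
    ext h m
    simp [actOnBase_zero]
  induction F with
  | zero => simp [hzero]
  | add x y hx hy => simp only [mul_add, hadd, hx, hy, LinearMap.add_apply]
  | tmul u G =>
  induction G with
  | zero => simp [hzero]
  | add x y hx hy => simp only [mul_add, TensorProduct.tmul_add, hadd, hx, hy, LinearMap.add_apply]
  | tmul v m =>
    have h1 : ∀ t : H ⊗[k] L, actOnBaseMul B (u ⊗ₜ[k] (v ⊗ₜ[k] m)) t =
        u ⊗ₜ[k] (v ⊗ₜ[k] LinearMap.mul' k L
          (TensorProduct.map (B.act.toLinearMap.flip m) LinearMap.id t)) := by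
      intro t
      induction t with
      | zero => simp
      | add x y hx hy => simp only [map_add, TensorProduct.tmul_add, hx, hy]
      | tmul h n => simp
    rw [h1, ← B.quasi_comm]
    simp

/-- Moving l^[∞] to the right past F_L makes a second coaction leg act on F_L. By coassociativity
the two Hopf legs are h⁽¹⁾ and h⁽²⁾ of a single h, which is the configuration in the invariance of
F. -/
lemma IsDynamicalTwist.commute_comulFirst_coactU {j : H →ₐc[k] U} {B : BaseAlgebra k H L}
    {F : (U ⊗[k] (U ⊗[k] L))ˣ} (hF : IsDynamicalTwist j B F) (l : L) :
    Commute (comulFirst k U L (coactU j B l)) (F : U ⊗[k] (U ⊗[k] L)) := by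
  set c : H →ₗ[k] U ⊗[k] (U ⊗[k] L) :=
    (constTensor k U L).toLinearMap ∘ₗ Coalgebra.comul ∘ₗ (j : H →ₐ[k] U).toLinearMap with hc
  have hc' : ∀ h, constTensor k U L (Coalgebra.comul (R := k) (j h)) = c h := fun h => rfl
  have h0 : ∀ t : H ⊗[k] L, comulFirst k U L
      (Algebra.TensorProduct.map (j : H →ₐ[k] U) (AlgHom.id k L) t) =
      LinearMap.mul' k _ (TensorProduct.map c
        (TensorProduct.mk k U (U ⊗[k] L) 1 ∘ₗ TensorProduct.mk k U L 1) t) := by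
    intro t
    induction t with
    | zero => simp
    | add x y hx hy => simp only [map_add, hx, hy]
    | tmul h m =>
      have h2 : ∀ s : U ⊗[k] U, TensorProduct.assoc k U U L (s ⊗ₜ[k] m) =
          constTensor k U L s * (1 ⊗ₜ[k] (1 ⊗ₜ[k] m)) := by
        intro s
        induction s with
        | zero => simp
        | add x y hx hy => simp only [map_add, TensorProduct.add_tmul, add_mul, hx, hy]
        | tmul x y => simp [constTensor]
      rw [Algebra.TensorProduct.map_tmul, AlgHom.coe_id, id_eq, comulFirst_tmul, h2]
      simp only [TensorProduct.map_tmul, LinearMap.mul'_apply, ← hc']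
      rfl
  have h1 : ∀ t : H ⊗[k] L, LinearMap.mul' k _ (TensorProduct.map c
        (TensorProduct.mk k U (U ⊗[k] L) 1 ∘ₗ TensorProduct.mk k U L 1) t) * F =
      LinearMap.mul' k _ (TensorProduct.map c (actOnBaseMul B F)
        (B.coact.toLinearMap.lTensor H t)) := by
    intro t
    induction t with
    | zero => simp
    | add x y hx hy => simp only [map_add, add_mul, hx, hy]
    | tmul h m =>
      have := base_mul_eq_actOnBaseMul B (F : U ⊗[k] (U ⊗[k] L)) m
      simp only [TensorProduct.map_tmul, LinearMap.mul'_apply, LinearMap.lTensor_tmul,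
        LinearMap.comp_apply, TensorProduct.mk_apply, AlgHom.toLinearMap_apply, mul_assoc, this]
  have h2 : ∀ t : H ⊗[k] L, LinearMap.mul' k _ (TensorProduct.map c (actOnBaseMul B F)
        (TensorProduct.assoc k H H L ((Coalgebra.comul (R := k) (A := H)).rTensor L t))) =
      F * LinearMap.mul' k _ (TensorProduct.map c
        (TensorProduct.mk k U (U ⊗[k] L) 1 ∘ₗ TensorProduct.mk k U L 1) t) := by
    intro t
    induction t with
    | zero => simp
    | add x y hx hy => simp only [map_add, mul_add, hx, hy]
    | tmul h m =>
      have h3 : ∀ s : H ⊗[k] H, LinearMap.mul' k _ (TensorProduct.map c (actOnBaseMul B F)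
          (TensorProduct.assoc k H H L (s ⊗ₜ[k] m))) =
          LinearMap.mul' k _ (TensorProduct.map c (actOnBase B (F : U ⊗[k] (U ⊗[k] L))) s) *
            (1 ⊗ₜ[k] (1 ⊗ₜ[k] m)) := by
        intro s
        induction s with
        | zero => simp
        | add x y hx hy => simp only [map_add, TensorProduct.add_tmul, add_mul, hx, hy]
        | tmul x y => simp [mul_assoc]
      rw [LinearMap.rTensor_tmul, h3, hF.invariant h, hc']
      simp only [TensorProduct.map_tmul, LinearMap.mul'_apply, LinearMap.comp_apply,
        TensorProduct.mk_apply, mul_assoc]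
  change comulFirst k U L (Algebra.TensorProduct.map (j : H →ₐ[k] U) (AlgHom.id k L) (B.coact l)) *
    F = F * comulFirst k U L
      (Algebra.TensorProduct.map (j : H →ₐ[k] U) (AlgHom.id k L) (B.coact l))
  rw [h0, h1, ← B.coact_coassoc, h2]

end Base

/-! ### Two conjugation identities in a monoid -/

/-- Abstract form of the use of the cocycle identity: c = F₍₁₂₎₃, d = F₁₂|₃, m = F₁₍₂₃₎, n = F₂₃,
with x in the last matrix leg. -/
lemma units_conj_eq_of_mul_eq {M : Type*} [Monoid M] {c d m n : Mˣ} {x : M} (h : c * d = m * n)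
    (hx : Commute (d : M) x) :
    (c : M) * x * (c⁻¹ : Mˣ) = m * (n * x * (n⁻¹ : Mˣ)) * (m⁻¹ : Mˣ) := by
  have h1 : (c : M) * x * (c⁻¹ : Mˣ) = (c * d : Mˣ) * x * ((c * d)⁻¹ : Mˣ) := by
    have h2 : (d : M) * x * (d⁻¹ : Mˣ) = x := by rw [hx.eq, mul_assoc, Units.mul_inv, mul_one]
    calc (c : M) * x * (c⁻¹ : Mˣ) = c * (d * x * (d⁻¹ : Mˣ)) * (c⁻¹ : Mˣ) := by rw [h2]
      _ = _ := by simp only [mul_inv_rev, Units.val_mul, mul_assoc]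
  rw [h1, h]
  simp only [mul_inv_rev, Units.val_mul, mul_assoc]

/-- Consequence of the reflection equation for `φ⁻¹ r f` and `f⁻¹ r' φ`. -/
lemma reflection_conj {M : Type*} [Monoid M] {f φ r r' : Mˣ} {x y : M}
    (h : Commute ((φ⁻¹ * r * f : Mˣ) * y * (f⁻¹ * r' * φ : Mˣ)) x) :
    f * y * (f⁻¹ : Mˣ) * (r' * (φ * x * (φ⁻¹ : Mˣ)) * (r'⁻¹ : Mˣ)) =
      (r⁻¹ : Mˣ) * (φ * x * (φ⁻¹ : Mˣ)) * r * (f * y * (f⁻¹ : Mˣ)) := by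
  have h1 := congrArg (fun z : M => (r⁻¹ : Mˣ) * (φ * z * (φ⁻¹ : Mˣ)) * (r'⁻¹ : Mˣ)) h.eq
  simpa [mul_assoc] using h1

/-! ### Dressed matrices and their coproduct -/

section Core

variable {k H U E L A : Type*} [Field k] [Ring H] [HopfAlgebra k H] [Ring U] [HopfAlgebra k U]
  [Ring E] [Algebra k E] [Ring L] [Algebra k L] [Ring A] [Algebra k A]

lemma comulFirst_onRight {M N : Type*} [Ring M] [Algebra k M] [Ring N] [Algebra k N]
    (f : M →ₐ[k] N) (g : U ⊗[k] M) :
    comulFirst k U N (onRight U f g) = onRight U (onRight U f) (comulFirst k U M g) := by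
  induction g with
  | zero => simp
  | add x y hx hy => simp only [map_add, hx, hy]
  | tmul x m => simp only [onRight_tmul, comulFirst_tmul_eq_sum, map_sum]

lemma counitFirst_onRight {M N : Type*} [Ring M] [Algebra k M] [Ring N] [Algebra k N]
    (f : M →ₐ[k] N) (g : U ⊗[k] M) :
    counitFirst k U N (onRight U f g) = f (counitFirst k U M g) := by
  induction g with
  | zero => simp
  | add x y hx hy => simp only [map_add, hx, hy]
  | tmul x m => simp

lemma comulRep_onRight {M N : Type*} [Ring M] [Algebra k M] [Ring N] [Algebra k N]
    (ρ : U →ₐ[k] E) (f : M →ₐ[k] N) (g : U ⊗[k] M) :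
    comulRep ρ N (onRight U f g) =
      onRight U (Algebra.TensorProduct.map ρ f) (comulFirst k U M g) := by
  induction g with
  | zero => simp
  | add x y hx hy => simp only [map_add, hx, hy]
  | tmul x m =>
    rw [comulRep, AlgHom.comp_apply, onRight_tmul, comulFirst_tmul_eq_sum, comulFirst_tmul_eq_sum,
      map_sum, map_sum]
    simp

/-- `ρ ⊗ s`. -/
def repBase (ρ : U →ₐ[k] E) (s : L →ₐ[k] A) : U ⊗[k] L →ₐ[k] E ⊗[k] A :=
  Algebra.TensorProduct.map ρ s

@[simp] lemma repBase_tmul (ρ : U →ₐ[k] E) (s : L →ₐ[k] A) (u : U) (l : L) :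
    repBase ρ s (u ⊗ₜ[k] l) = ρ u ⊗ₜ[k] s l := rfl

/-- `ρ ⊗ ρ ⊗ s`. -/
def repTwist (ρ : U →ₐ[k] E) (s : L →ₐ[k] A) : U ⊗[k] (U ⊗[k] L) →ₐ[k] E ⊗[k] (E ⊗[k] A) :=
  Algebra.TensorProduct.map ρ (repBase ρ s)

@[simp] lemma repTwist_tmul (ρ : U →ₐ[k] E) (s : L →ₐ[k] A) (u : U) (x : U ⊗[k] L) :
    repTwist ρ s (u ⊗ₜ[k] x) = ρ u ⊗ₜ[k] repBase ρ s x := rfl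

/-- The element `F X F⁻¹` of `U ⊗ E ⊗ A`, for `X ∈ E ⊗ A`. -/
def dress (ρ : U →ₐ[k] E) (s : L →ₐ[k] A) (F : (U ⊗[k] (U ⊗[k] L))ˣ) (X : E ⊗[k] A) :
    U ⊗[k] (E ⊗[k] A) :=
  onRight U (repBase ρ s) F * (1 ⊗ₜ[k] X) *
    onRight U (repBase ρ s) (F⁻¹ : (U ⊗[k] (U ⊗[k] L))ˣ)

variable {ρ : U →ₐ[k] E} {s : L →ₐ[k] A} {j : H →ₐc[k] U} {B : BaseAlgebra k H L}
  {F : (U ⊗[k] (U ⊗[k] L))ˣ} {X : E ⊗[k] A}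

lemma commute_onRight_coactU (hX : ∀ l, Commute (repBase ρ s (coactU j B l)) X)
    (G : U ⊗[k] L) :
    Commute (onRight U (repBase ρ s) (onRight U (coactU j B) G)) (1 ⊗ₜ[k] X) := by
  induction G with
  | zero => simp
  | add x y hx hy => rw [map_add, map_add]; exact hx.add_left hy
  | tmul u l =>
    have := (hX l).eq
    simp [Commute, SemiconjBy, this]

lemma commute_onRight_onRight_coactU (hX : ∀ l, Commute (repBase ρ s (coactU j B l)) X)
    (G : U ⊗[k] (U ⊗[k] L)) :
    Commute (onRight U (onRight U (repBase ρ s)) (onRight U (onRight U (coactU j B)) G))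
      (1 ⊗ₜ[k] (1 ⊗ₜ[k] X)) := by
  induction G with
  | zero => simp
  | add x y hx hy => rw [map_add, map_add]; exact hx.add_left hy
  | tmul u G =>
    have := (commute_onRight_coactU hX G).eq
    simp [Commute, SemiconjBy, this]

/-- Conjugating X by F₍₁₂₎₃ is the same as conjugating by F₍₁₂₎₃F₁₂|₃ = F₁₍₂₃₎F₂₃, because the base
leg of F₁₂|₃ meets X only through the coaction, whose image commutes with X. -/
lemma IsDynamicalTwist.comulFirst_dress (hF : IsDynamicalTwist j B F)
    (hX : ∀ l, Commute (repBase ρ s (coactU j B l)) X) :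
    comulFirst k U (E ⊗[k] A) (dress ρ s F X) =
      onRight U (onRight U (repBase ρ s)) (onRight U (comulFirst k U L) F) *
        (1 ⊗ₜ[k] dress ρ s F X) *
        onRight U (onRight U (repBase ρ s))
          (onRight U (comulFirst k U L) (F⁻¹ : (U ⊗[k] (U ⊗[k] L))ˣ)) := by
  set Ψ := onRight U (onRight U (repBase ρ s)) with hΨ
  have hu : Units.map (Ψ.comp (comulFirst k U (U ⊗[k] L))).toMonoidHom F *
      Units.map (Ψ.comp (onRight U (onRight U (coactU j B)))).toMonoidHom F =
      Units.map (Ψ.comp (onRight U (comulFirst k U L))).toMonoidHom F *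
      Units.map (Ψ.comp (Algebra.TensorProduct.includeRight :
        U ⊗[k] (U ⊗[k] L) →ₐ[k] U ⊗[k] (U ⊗[k] (U ⊗[k] L)))).toMonoidHom F := by
    refine Units.ext ?_
    have := congrArg Ψ hF.cocycle
    rw [map_mul, map_mul] at this
    exact this
  have hc := units_conj_eq_of_mul_eq hu
    (x := (1 : U) ⊗ₜ[k] ((1 : U) ⊗ₜ[k] X)) (commute_onRight_onRight_coactU hX F)
  have h1 : ∀ G : U ⊗[k] (U ⊗[k] L), comulFirst k U (E ⊗[k] A) (onRight U (repBase ρ s) G) =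
      Ψ (comulFirst k U (U ⊗[k] L) G) := fun G => comulFirst_onRight _ G
  have h2 : comulFirst k U (E ⊗[k] A) (1 ⊗ₜ[k] X) = 1 ⊗ₜ[k] (1 ⊗ₜ[k] X) := by
    rw [comulFirst_tmul, Bialgebra.comul_one, Algebra.TensorProduct.one_def]
    simp
  rw [dress, map_mul, map_mul, h1, h1, h2]
  refine hc.trans ?_
  congr 2
  have h3 : ∀ G : U ⊗[k] (U ⊗[k] L), Ψ (1 ⊗ₜ[k] G) = 1 ⊗ₜ[k] onRight U (repBase ρ s) G :=
    fun G => by simp [hΨ]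
  change Ψ (1 ⊗ₜ[k] (F : U ⊗[k] (U ⊗[k] L))) * _ *
    Ψ (1 ⊗ₜ[k] ((F⁻¹ : (U ⊗[k] (U ⊗[k] L))ˣ) : U ⊗[k] (U ⊗[k] L))) = _
  rw [h3, h3]
  simp

end Core

/-! ### Invariance of the trace of a dressed matrix; commutation with the base algebra -/

section Centrality

variable {k H U E L A : Type*} [Field k] [Ring H] [HopfAlgebra k H] [Ring U] [HopfAlgebra k U]
  [Ring E] [Algebra k E] [Ring L] [Algebra k L] [Ring A] [Algebra k A]

lemma onRight_onRight {M N P : Type*} [Ring M] [Algebra k M] [Ring N] [Algebra k N] [Ring P]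
    [Algebra k P] (g : N →ₐ[k] P) (f : M →ₐ[k] N) (x : U ⊗[k] M) :
    onRight U g (onRight U f x) = onRight U (g.comp f) x := by
  induction x with
  | zero => simp
  | add x y hx hy => simp only [map_add, hx, hy]
  | tmul u m => simp

variable {ρ : U →ₐ[k] E} {s : L →ₐ[k] A} {j : H →ₐc[k] U} {B : BaseAlgebra k H L}
  {F : (U ⊗[k] (U ⊗[k] L))ˣ} {X : E ⊗[k] A} {tr : E →ₗ[k] k} {m : U}

lemma onRight_repBase_onRight_comulFirst (ρ : U →ₐ[k] E) (s : L →ₐ[k] A)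
    (G : U ⊗[k] (U ⊗[k] L)) :
    onRight U (onRight U (repBase ρ s)) (onRight U (comulFirst k U L) G) =
      onRight U (comulRep ρ A) (onRight U (onRight U s) G) := by
  rw [onRight_onRight, onRight_onRight]
  congr 2
  exact AlgHom.ext fun x => (comulRep_onRight ρ s x).symm

lemma IsDynamicalTwist.counitFirst_onRight_inv (hF : IsDynamicalTwist j B F) :
    onRight U (counitFirst k U L) ((F⁻¹ : (U ⊗[k] (U ⊗[k] L))ˣ) : U ⊗[k] (U ⊗[k] L)) = 1 := by
  have h1 : Units.map (onRight U (counitFirst k U L)).toMonoidHom F = 1 :=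
    Units.ext hF.counit_right
  have h2 := congrArg (fun u : (U ⊗[k] L)ˣ => ((u⁻¹ : _ˣ) : U ⊗[k] L)) h1
  rw [inv_one] at h2
  exact h2

lemma IsDynamicalTwist.counitFirst_inv (hF : IsDynamicalTwist j B F) :
    counitFirst k U (U ⊗[k] L) ((F⁻¹ : (U ⊗[k] (U ⊗[k] L))ˣ) : U ⊗[k] (U ⊗[k] L)) = 1 := by
  have h1 : Units.map (counitFirst k U (U ⊗[k] L)).toMonoidHom F = 1 :=
    Units.ext hF.counit_left
  have h2 := congrArg (fun u : (U ⊗[k] L)ˣ => ((u⁻¹ : _ˣ) : U ⊗[k] L)) h1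
  rw [inv_one] at h2
  exact h2

/-- After ρ is applied, F₁₍₂₃₎ is a comultiplied factor in the two legs seen by τ, so τ replaces it
by (id ⊗ ε ⊗ id)F = 1; likewise for its inverse. -/
lemma IsDynamicalTwist.repTwistedTrace_comulFirst_dress (hF : IsDynamicalTwist j B F)
    (hX : ∀ l, Commute (repBase ρ s (coactU j B l)) X)
    (htr : ∀ x y, tr (x * y) = tr (y * x)) (hm : IsTwistingElement k m) :
    repTwistedTrace tr ρ m A (comulFirst k U (E ⊗[k] A) (dress ρ s F X)) =
      1 ⊗ₜ[k] twistedTrace tr ρ m A (dress ρ s F X) := by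
  have h : ∀ G : U ⊗[k] (U ⊗[k] L), onRight U (counitFirst k U L) G = 1 →
      Algebra.TensorProduct.map ρ (AlgHom.id k A)
        (onRight U (counitFirst k U A) (onRight U (onRight U s) G)) = 1 := by
    intro G hG
    have : onRight U (counitFirst k U A) (onRight U (onRight U s) G) =
        onRight U s (onRight U (counitFirst k U L) G) := by
      rw [onRight_onRight, onRight_onRight]
      congr 2
      exact AlgHom.ext fun x => counitFirst_onRight s x
    rw [this, hG, map_one, map_one]
  rw [hF.comulFirst_dress hX, onRight_repBase_onRight_comulFirst,
    onRight_repBase_onRight_comulFirst, repTwistedTrace_mul_onRight_comulRep htr ρ hm,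
    repTwistedTrace_onRight_comulRep_mul, h _ hF.counit_right, h _ hF.counitFirst_onRight_inv,
    one_mul, mul_one, repTwistedTrace_tmul, map_one]

/-- The element (Δ ⊗ id)δ(l) commutes with F, and, being (id ⊗ δ)δ(l), its image commutes with X
too. Hence it commutes with D(X), and τ reduces it to s(l) on either side. -/
lemma IsDynamicalTwist.commute_base_twistedTrace (hF : IsDynamicalTwist j B F)
    (hX : ∀ l, Commute (repBase ρ s (coactU j B l)) X)
    (htr : ∀ x y, tr (x * y) = tr (y * x)) (hm : IsTwistingElement k m) (l : L) :
    Commute (s l) (twistedTrace tr ρ m A (dress ρ s F X)) := by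
  have h1 : counitFirst k U A (onRight U s (coactU j B l)) = s l := by
    rw [counitFirst_onRight, counitFirst_coactU]
  have h2 : comulRep ρ A (onRight U s (coactU j B l)) =
      onRight U (repBase ρ s) (comulFirst k U L (coactU j B l)) := comulRep_onRight ρ s _
  have h3 : Commute (onRight U (repBase ρ s) (comulFirst k U L (coactU j B l)))
      (dress ρ s F X) := by
    have hc := hF.commute_comulFirst_coactU l
    have hc' : Commute (comulFirst k U L (coactU j B l))
        ((F⁻¹ : (U ⊗[k] (U ⊗[k] L))ˣ) : U ⊗[k] (U ⊗[k] L)) := hc.units_inv_right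
    refine ((hc.map (onRight U (repBase ρ s))).mul_right ?_).mul_right
      (hc'.map (onRight U (repBase ρ s)))
    rw [comulFirst_coactU]
    exact commute_onRight_coactU hX _
  have h4 := congrArg (twistedTrace tr ρ m A) h3.eq
  rw [← h2, twistedTrace_comulRep_mul, twistedTrace_mul_comulRep htr ρ hm, h1] at h4
  exact h4

lemma IsDynamicalTwist.comulRep_dress (hF : IsDynamicalTwist j B F)
    (hX : ∀ l, Commute (repBase ρ s (coactU j B l)) X) :
    comulRep ρ (E ⊗[k] A) (dress ρ s F X) =
      onRight U (repTwist ρ s) (onRight U (comulFirst k U L) F) *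
        (1 ⊗ₜ[k] (repTwist ρ s F * (1 ⊗ₜ[k] X) *
          repTwist ρ s (F⁻¹ : (U ⊗[k] (U ⊗[k] L))ˣ))) *
        onRight U (repTwist ρ s)
          (onRight U (comulFirst k U L) (F⁻¹ : (U ⊗[k] (U ⊗[k] L))ˣ)) := by
  have h1 : ∀ G : U ⊗[k] (U ⊗[k] L), Algebra.TensorProduct.map ρ (AlgHom.id k (E ⊗[k] A))
      (onRight U (repBase ρ s) G) = repTwist ρ s G := by
    intro G
    induction G with
    | zero => simp
    | add x y hx hy => simp only [map_add, hx, hy]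
    | tmul u G => simp
  have h2 : ∀ G : U ⊗[k] (U ⊗[k] (U ⊗[k] L)),
      onRight U (Algebra.TensorProduct.map ρ (AlgHom.id k (E ⊗[k] A)))
      (onRight U (onRight U (repBase ρ s)) G) = onRight U (repTwist ρ s) G := by
    intro G
    rw [onRight_onRight]
    congr 2
    exact AlgHom.ext h1
  rw [comulRep, AlgHom.comp_apply, hF.comulFirst_dress hX, map_mul, map_mul, h2, h2,
    onRight_tmul, dress, map_mul, map_mul, h1, h1]
  simp

local notation "σ" => Algebra.TensorProduct.leftComm k E E A

lemma repTwist_leftComm (ρ : U →ₐ[k] E) (s : L →ₐ[k] A) (G : U ⊗[k] (U ⊗[k] L)) :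
    repTwist ρ s (Algebra.TensorProduct.leftComm k U U L G) = σ (repTwist ρ s G) := by
  induction G with
  | zero => simp
  | add x y hx hy => simp only [map_add, hx, hy]
  | tmul u G =>
    induction G with
    | zero => simp
    | add x y hx hy => simp only [map_add, TensorProduct.tmul_add, hx, hy]
    | tmul v l => simp

lemma repTwist_constTensor (ρ : U →ₐ[k] E) (s : L →ₐ[k] A) (t : U ⊗[k] U) :
    repTwist ρ s (constTensor k U L t) = repConst ρ A t := by
  induction t with
  | zero => simp
  | add x y hx hy => simp only [map_add, hx, hy]
  | tmul u v => simp [constTensor]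

lemma repConst_comm (ρ : U →ₐ[k] E) (t : U ⊗[k] U) :
    repConst ρ A (TensorProduct.comm k U U t) = σ (repConst ρ A t) := by
  induction t with
  | zero => simp
  | add x y hx hy => simp only [map_add, hx, hy]
  | tmul u v => simp

lemma repTwist_comulFirst_mul_repConst (ρ : U →ₐ[k] E) (s : L →ₐ[k] A) {Q : U ⊗[k] U}
    (hΔ : ∀ x : U, Coalgebra.comul x * Q = Q * TensorProduct.comm k U U (Coalgebra.comul x))
    (y : U ⊗[k] L) :
    repTwist ρ s (comulFirst k U L y) * repConst ρ A Q =
      repConst ρ A Q * σ (repTwist ρ s (comulFirst k U L y)) := by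
  induction y with
  | zero => simp
  | add x y hx hy => simp only [map_add, mul_add, add_mul, hx, hy]
  | tmul x l =>
    have h1 : ∀ t : U ⊗[k] U, repTwist ρ s (TensorProduct.assoc k U U L (t ⊗ₜ[k] l)) =
        repConst ρ A t * (1 ⊗ₜ[k] (1 ⊗ₜ[k] s l)) := by
      intro t
      induction t with
      | zero => simp
      | add x y hx hy => simp only [map_add, TensorProduct.add_tmul, add_mul, hx, hy]
      | tmul u v => simp
    have h2 : ∀ t : U ⊗[k] U, Commute (repConst ρ A t) (1 ⊗ₜ[k] (1 ⊗ₜ[k] s l)) := by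
      intro t
      induction t with
      | zero => simp
      | add x y hx hy => rw [map_add]; exact hx.add_left hy
      | tmul u v => simp [Commute, SemiconjBy]
    rw [comulFirst_tmul, h1, mul_assoc, ← (h2 Q).eq, ← mul_assoc, ← map_mul, hΔ, map_mul, map_mul,
      ← repConst_comm, mul_assoc]
    simp

lemma onRight_repTwist_mul_repConst (ρ : U →ₐ[k] E) (s : L →ₐ[k] A) {Q : U ⊗[k] U}
    (hΔ : ∀ x : U, Coalgebra.comul x * Q = Q * TensorProduct.comm k U U (Coalgebra.comul x))
    (G : U ⊗[k] (U ⊗[k] L)) :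
    onRight U (repTwist ρ s) (onRight U (comulFirst k U L) G) * (1 ⊗ₜ[k] repConst ρ A Q) =
      (1 ⊗ₜ[k] repConst ρ A Q) * onRight U (σ).toAlgHom
        (onRight U (repTwist ρ s) (onRight U (comulFirst k U L) G)) := by
  induction G with
  | zero => simp
  | add x y hx hy => simp only [map_add, mul_add, add_mul, hx, hy]
  | tmul u y => simp [repTwist_comulFirst_mul_repConst ρ s hΔ]

/-- Since Q intertwines Δ and Δᵒᵖ, it passes through F₁₍₂₃₎ and undoes the flip there. Only the
inner F X F⁻¹ stays flipped and conjugated by Q, so the outer factor does not depend on Q. -/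
lemma IsDynamicalTwist.repConst_conj_dress (hF : IsDynamicalTwist j B F)
    (hX : ∀ l, Commute (repBase ρ s (coactU j B l)) X) (Q : (U ⊗[k] U)ˣ)
    (hΔ : ∀ x : U, ((Q⁻¹ : (U ⊗[k] U)ˣ) : U ⊗[k] U) * Coalgebra.comul x *
      (Q : U ⊗[k] U) = TensorProduct.comm k U U (Coalgebra.comul x)) :
    (1 ⊗ₜ[k] repConst ρ A Q) *
        onRight U (σ).toAlgHom (comulRep ρ (E ⊗[k] A) (dress ρ s F X)) *
        (1 ⊗ₜ[k] repConst ρ A (Q⁻¹ : (U ⊗[k] U)ˣ)) =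
      onRight U (repTwist ρ s) (onRight U (comulFirst k U L) F) *
        (1 ⊗ₜ[k] (repConst ρ A Q * σ (repTwist ρ s F * (1 ⊗ₜ[k] X) *
          repTwist ρ s (F⁻¹ : (U ⊗[k] (U ⊗[k] L))ˣ)) * repConst ρ A (Q⁻¹ : (U ⊗[k] U)ˣ))) *
        onRight U (repTwist ρ s)
          (onRight U (comulFirst k U L) (F⁻¹ : (U ⊗[k] (U ⊗[k] L))ˣ)) := by
  have hQ : ∀ G : U ⊗[k] (U ⊗[k] L), _ := onRight_repTwist_mul_repConst ρ s
    (Q := (Q : U ⊗[k] U)) fun x => by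
      rw [← hΔ, mul_assoc, Units.mul_inv_cancel_left]
  have hq : repConst ρ A (Q : U ⊗[k] U) * repConst ρ A ((Q⁻¹ : (U ⊗[k] U)ˣ) : U ⊗[k] U) = 1 := by
    rw [← map_mul, Units.mul_inv, map_one]
  have hq' : repConst ρ A ((Q⁻¹ : (U ⊗[k] U)ˣ) : U ⊗[k] U) * repConst ρ A (Q : U ⊗[k] U) = 1 := by
    rw [← map_mul, Units.inv_mul, map_one]
  have hQ' : ∀ G : U ⊗[k] (U ⊗[k] L), onRight U (σ).toAlgHom
        (onRight U (repTwist ρ s) (onRight U (comulFirst k U L) G)) *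
        (1 ⊗ₜ[k] repConst ρ A ((Q⁻¹ : (U ⊗[k] U)ˣ) : U ⊗[k] U)) =
      (1 ⊗ₜ[k] repConst ρ A ((Q⁻¹ : (U ⊗[k] U)ˣ) : U ⊗[k] U)) *
        onRight U (repTwist ρ s) (onRight U (comulFirst k U L) G) := by
    intro G
    have h := congrArg (fun z => ((1 : U) ⊗ₜ[k] repConst ρ A ((Q⁻¹ : (U ⊗[k] U)ˣ) : U ⊗[k] U)) * z *
      ((1 : U) ⊗ₜ[k] repConst ρ A ((Q⁻¹ : (U ⊗[k] U)ˣ) : U ⊗[k] U))) (hQ G)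
    rw [mul_assoc, mul_assoc, Algebra.TensorProduct.tmul_mul_tmul, hq, ← mul_assoc, ← mul_assoc,
      Algebra.TensorProduct.tmul_mul_tmul, hq', mul_one, ← Algebra.TensorProduct.one_def, mul_one,
      one_mul] at h
    exact h.symm
  rw [hF.comulRep_dress hX, map_mul, map_mul, ← mul_assoc, ← mul_assoc, ← hQ, mul_assoc _ _
    ((1 : U) ⊗ₜ[k] repConst ρ A ((Q⁻¹ : (U ⊗[k] U)ˣ) : U ⊗[k] U)), hQ']
  simp only [← mul_assoc]
  congr 1
  simp only [mul_assoc, onRight_tmul, Algebra.TensorProduct.tmul_mul_tmul, mul_one]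
  rfl

end Centrality

/-! ### The reflection equation, commutation with K, and comparison with the dynamical trace -/

section CentralityR

variable {k H U E L A : Type*} [Field k] [Ring H] [HopfAlgebra k H] [Ring U] [HopfAlgebra k U]
  [Ring E] [Algebra k E] [Ring L] [Algebra k L] [Ring A] [Algebra k A]

variable {ρ : U →ₐ[k] E} {s : L →ₐ[k] A} {j : H →ₐc[k] U} {B : BaseAlgebra k H L}
  {F : (U ⊗[k] (U ⊗[k] L))ˣ} {K X : E ⊗[k] A} {tr : E →ₗ[k] k} {R : (U ⊗[k] U)ˣ}

local notation "σ" => Algebra.TensorProduct.leftComm k E E A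

local notation "γ" => HopfAlgebra.antipode k (A := U)

lemma IsUniversalRMatrix.isTwistingElement (hR : IsUniversalRMatrix R) :
    IsTwistingElement k (drinfeldMu R) := hR.comul_mul_drinfeldMu_mul_antipode

lemma IsUniversalRMatrix.antipode_rTensor_comm_inv (hR : IsUniversalRMatrix R) :
    (γ).rTensor U (TensorProduct.comm k U U ((R⁻¹ : (U ⊗[k] U)ˣ) : U ⊗[k] U)) =
      TensorProduct.comm k U U (R : U ⊗[k] U) := by
  rw [← hR.antipode_lTensor_inv]
  generalize ((R⁻¹ : (U ⊗[k] U)ˣ) : U ⊗[k] U) = t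
  induction t with
  | zero => simp
  | add x y hx hy => simp only [map_add, hx, hy]
  | tmul a b => simp

lemma IsUniversalRMatrix.conj_comul (hR : IsUniversalRMatrix R) (x : U) :
    (R : U ⊗[k] U) * Coalgebra.comul x * ((R⁻¹ : (U ⊗[k] U)ˣ) : U ⊗[k] U) =
      TensorProduct.comm k U U (Coalgebra.comul x) := by
  rw [hR.intertwines, Units.mul_inv_cancel_right]

lemma comm_mul (x y : U ⊗[k] U) : TensorProduct.comm k U U (x * y) =
    TensorProduct.comm k U U x * TensorProduct.comm k U U y :=
  map_mul (Algebra.TensorProduct.comm k U U) x y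

/-- The element `R₂₁`. -/
def flipUnit (R : (U ⊗[k] U)ˣ) : (U ⊗[k] U)ˣ :=
  Units.map (Algebra.TensorProduct.comm k U U).toAlgHom.toMonoidHom R

lemma coe_flipUnit (R : (U ⊗[k] U)ˣ) :
    (flipUnit R : U ⊗[k] U) = TensorProduct.comm k U U (R : U ⊗[k] U) := rfl

lemma coe_inv_flipUnit (R : (U ⊗[k] U)ˣ) :
    (((flipUnit R)⁻¹ : (U ⊗[k] U)ˣ) : U ⊗[k] U) =
      TensorProduct.comm k U U ((R⁻¹ : (U ⊗[k] U)ˣ) : U ⊗[k] U) := rfl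

lemma IsUniversalRMatrix.flip_conj_comul (hR : IsUniversalRMatrix R) (x : U) :
    (((flipUnit R)⁻¹ : (U ⊗[k] U)ˣ) : U ⊗[k] U) * Coalgebra.comul x * (flipUnit R : U ⊗[k] U) =
      TensorProduct.comm k U U (Coalgebra.comul x) := by
  rw [coe_inv_flipUnit, coe_flipUnit]
  apply (TensorProduct.comm k U U).injective
  rw [comm_mul, comm_mul, TensorProduct.comm_comm, TensorProduct.comm_comm,
    TensorProduct.comm_comm, mul_assoc, ← hR.intertwines, Units.inv_mul_cancel_left]

/-- The reflection equation for `K`, and its consequence for the powers of `K`. -/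
lemma reflection_pow
    (hRE : σ (repTwist ρ s (dynR R F)) * σ (1 ⊗ₜ[k] K) * repTwist ρ s (dynR R F) * (1 ⊗ₜ[k] K) =
      (1 ⊗ₜ[k] K) * σ (repTwist ρ s (dynR R F)) * σ (1 ⊗ₜ[k] K) * repTwist ρ s (dynR R F))
    (n : ℕ) :
    repTwist ρ s F * (1 ⊗ₜ[k] K) * repTwist ρ s (F⁻¹ : (U ⊗[k] (U ⊗[k] L))ˣ) *
      (repConst ρ A (flipUnit R) * σ (repTwist ρ s F * (1 ⊗ₜ[k] (K ^ n)) *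
        repTwist ρ s (F⁻¹ : (U ⊗[k] (U ⊗[k] L))ˣ)) *
        repConst ρ A ((flipUnit R)⁻¹ : (U ⊗[k] U)ˣ)) =
    repConst ρ A (R⁻¹ : (U ⊗[k] U)ˣ) * σ (repTwist ρ s F * (1 ⊗ₜ[k] (K ^ n)) *
        repTwist ρ s (F⁻¹ : (U ⊗[k] (U ⊗[k] L))ˣ)) * repConst ρ A R *
      (repTwist ρ s F * (1 ⊗ₜ[k] K) * repTwist ρ s (F⁻¹ : (U ⊗[k] (U ⊗[k] L))ˣ)) := by
  have hσ : ∀ z : E ⊗[k] (E ⊗[k] A), σ (σ z) = z := by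
    intro z
    induction z with
    | zero => simp
    | add x y hx hy => simp only [map_add, hx, hy]
    | tmul u G =>
      induction G with
      | zero => simp
      | add x y hx hy => simp only [map_add, TensorProduct.tmul_add, hx, hy]
      | tmul v l => simp
  have h1 : repTwist ρ s (dynR R F) = σ (repTwist ρ s (F⁻¹ : (U ⊗[k] (U ⊗[k] L))ˣ)) *
      repConst ρ A R * repTwist ρ s F := by
    rw [dynR, map_mul, map_mul, repTwist_leftComm, repTwist_constTensor]
  have h2 : σ (repTwist ρ s (dynR R F)) = repTwist ρ s (F⁻¹ : (U ⊗[k] (U ⊗[k] L))ˣ) *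
      repConst ρ A (flipUnit R) * σ (repTwist ρ s F) := by
    rw [h1, map_mul, map_mul, hσ, ← repConst_comm, coe_flipUnit]
  -- The flipped reflection equation says that R̃ K₂ R̃₂₁ commutes with K₁, and therefore with every
  -- power of K₁.
  have h3 : Commute (repTwist ρ s (dynR R F) * (1 ⊗ₜ[k] K) * σ (repTwist ρ s (dynR R F)))
      (σ (1 ⊗ₜ[k] K)) := by
    have := congrArg (σ) hRE
    simp only [map_mul, hσ] at this
    rw [Commute, SemiconjBy, this]
    simp only [mul_assoc]
  have h4 := h3.pow_right n
  rw [← map_pow, Algebra.TensorProduct.tmul_pow, one_pow, h2, h1] at h4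
  have h5 := reflection_conj (f := Units.map (repTwist ρ s).toMonoidHom F)
    (φ := Units.map ((σ).toAlgHom.comp (repTwist ρ s)).toMonoidHom F)
    (r := Units.map (repConst ρ A).toMonoidHom R)
    (r' := Units.map (repConst ρ A).toMonoidHom (flipUnit R)) (y := 1 ⊗ₜ[k] K)
    (x := σ (1 ⊗ₜ[k] (K ^ n))) h4
  rw [map_mul, map_mul]
  exact h5

/-- The spectator leg E ⊗ A is taken as coefficient algebra of τ, so that applying τ to one identity
in U ⊗ E ⊗ E ⊗ A gives commutation with all of K at once. -/
theorem commute_generator_twistedTrace (hR : IsUniversalRMatrix R) (hF : IsDynamicalTwist j B F)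
    (hK : ∀ l, Commute (repBase ρ s (coactU j B l)) K)
    (htr : ∀ x y, tr (x * y) = tr (y * x))
    (hRE : σ (repTwist ρ s (dynR R F)) * σ (1 ⊗ₜ[k] K) * repTwist ρ s (dynR R F) * (1 ⊗ₜ[k] K) =
      (1 ⊗ₜ[k] K) * σ (repTwist ρ s (dynR R F)) * σ (1 ⊗ₜ[k] K) * repTwist ρ s (dynR R F))
    (n : ℕ) :
    Commute K (1 ⊗ₜ[k] twistedTrace tr ρ (drinfeldMu R) A (dress ρ s F (K ^ n))) := by
  have hX : ∀ l, Commute (repBase ρ s (coactU j B l)) (K ^ n) := fun l => (hK l).pow_right n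
  have hc : ∀ Q : (U ⊗[k] U)ˣ, (γ).rTensor U ((Q⁻¹ : (U ⊗[k] U)ˣ) : U ⊗[k] U) = Q →
      (∀ x : U, ((Q⁻¹ : (U ⊗[k] U)ˣ) : U ⊗[k] U) * Coalgebra.comul x * (Q : U ⊗[k] U) =
        TensorProduct.comm k U U (Coalgebra.comul x)) →
      twistedTrace tr ρ (drinfeldMu R) (E ⊗[k] A) ((1 ⊗ₜ[k] repConst ρ A Q) *
        onRight U (σ).toAlgHom (comulRep ρ (E ⊗[k] A) (dress ρ s F (K ^ n))) *
        (1 ⊗ₜ[k] repConst ρ A (Q⁻¹ : (U ⊗[k] U)ˣ))) =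
      1 ⊗ₜ[k] twistedTrace tr ρ (drinfeldMu R) A (dress ρ s F (K ^ n)) := fun Q h1 h2 => by
    rw [twistedTrace_conj_comulRep htr ρ hR.mul_drinfeldMu h1 h2,
      hF.repTwistedTrace_comulFirst_dress hX htr hR.isTwistingElement]
  have hγ1 := hR.antipode_rTensor_comm_inv
  have hγ2 := hR.antipode_rTensor
  -- The counit removes the dressing because (ε ⊗ id ⊗ id)F = 1; this is what the factor D(K) leaves
  -- outside τ.
  have hKε : counitFirst k U (E ⊗[k] A) (dress ρ s F K) = K := by
    rw [dress, map_mul, map_mul, counitFirst_onRight, counitFirst_onRight, hF.counit_left,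
      hF.counitFirst_inv, counitFirst_tmul]
    simp
  -- All four factors are conjugates by the same F₁₍₂₃₎, so the identity reduces to the reflection
  -- equation for the inner factors.
  have key : comulRep ρ (E ⊗[k] A) (dress ρ s F K) * ((1 ⊗ₜ[k] repConst ρ A (flipUnit R)) *
        onRight U (σ).toAlgHom (comulRep ρ (E ⊗[k] A) (dress ρ s F (K ^ n))) *
        (1 ⊗ₜ[k] repConst ρ A ((flipUnit R)⁻¹ : (U ⊗[k] U)ˣ))) =
      ((1 ⊗ₜ[k] repConst ρ A ((R⁻¹ : (U ⊗[k] U)ˣ) : U ⊗[k] U)) *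
        onRight U (σ).toAlgHom (comulRep ρ (E ⊗[k] A) (dress ρ s F (K ^ n))) *
        (1 ⊗ₜ[k] repConst ρ A ((R⁻¹⁻¹ : (U ⊗[k] U)ˣ) : U ⊗[k] U))) *
        comulRep ρ (E ⊗[k] A) (dress ρ s F K) := by
    have hM : onRight U (repTwist ρ s) (onRight U (comulFirst k U L)
          ((F⁻¹ : (U ⊗[k] (U ⊗[k] L))ˣ) : U ⊗[k] (U ⊗[k] L))) *
        onRight U (repTwist ρ s) (onRight U (comulFirst k U L) F) = 1 := by
      rw [← map_mul, ← map_mul, Units.inv_mul, map_one, map_one]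
    have cancel : ∀ a b z w : U ⊗[k] (E ⊗[k] (E ⊗[k] A)), b * a = 1 →
        (a * z * b) * (a * w * b) = a * (z * w) * b := by
      intro a b z w h
      calc (a * z * b) * (a * w * b) = a * z * (b * a) * w * b := by simp only [mul_assoc]
        _ = _ := by rw [h, mul_one]; simp only [mul_assoc]
    rw [hF.repConst_conj_dress hX (flipUnit R) hR.flip_conj_comul,
      hF.repConst_conj_dress hX R⁻¹ (by simpa using hR.conj_comul),
      hF.comulRep_dress hK, cancel _ _ _ _ hM, cancel _ _ _ _ hM,
      Algebra.TensorProduct.tmul_mul_tmul, Algebra.TensorProduct.tmul_mul_tmul,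
      reflection_pow hRE, inv_inv]
  have h := congrArg (twistedTrace tr ρ (drinfeldMu R) (E ⊗[k] A)) key
  rw [twistedTrace_comulRep_mul, twistedTrace_mul_comulRep htr ρ hR.isTwistingElement, hKε,
    hc _ hγ1 hR.flip_conj_comul, hc R⁻¹ (by simpa using hγ2) (by simpa using hR.conj_comul)] at h
  exact h

/-- `tr ⊗ id : E ⊗ A → A`. -/
def partialTrace (tr : E →ₗ[k] k) (A : Type*) [Ring A] [Algebra k A] : E ⊗[k] A →ₗ[k] A :=
  (TensorProduct.lid k A).toLinearMap ∘ₗ tr.rTensor A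

@[simp] lemma partialTrace_tmul (tr : E →ₗ[k] k) (e : E) (a : A) :
    partialTrace tr A (e ⊗ₜ[k] a) = tr e • a := by
  simp [partialTrace]

lemma partialTrace_mul_tmul_one (htr : ∀ x y, tr (x * y) = tr (y * x)) (z : E ⊗[k] A) (e : E) :
    partialTrace tr A (z * (e ⊗ₜ[k] 1)) = partialTrace tr A ((e ⊗ₜ[k] 1) * z) := by
  induction z with
  | zero => simp
  | add x y hx hy => simp only [map_add, mul_add, add_mul, hx, hy]
  | tmul x a => simp [htr x e]

lemma twistedTrace_tmul_eq_partialTrace (ρ : U →ₐ[k] E) (m u : U) (z : E ⊗[k] A) :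
    twistedTrace tr ρ m A (u ⊗ₜ[k] z) = partialTrace tr A ((ρ (m * (γ) u) ⊗ₜ[k] 1) * z) := by
  induction z with
  | zero => simp
  | add x y hx hy => simp only [map_add, TensorProduct.tmul_add, mul_add, hx, hy]
  | tmul x a => simp

/-- Quasitriangularity rules out the default value 0 of `antipodeInv`. -/
lemma IsUniversalRMatrix.antipode_antipodeInv (hR : IsUniversalRMatrix R) (x : U) :
    (γ) (antipodeInv k U x) = x := by
  rw [antipodeInv, dif_pos hR.antipode_bijective]
  exact (LinearEquiv.ofBijective _ hR.antipode_bijective).apply_symm_apply x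

theorem twistedTrace_dress (hR : IsUniversalRMatrix R) (htr : ∀ x y, tr (x * y) = tr (y * x)) :
    twistedTrace tr ρ (drinfeldMu R) A (dress ρ s F X) =
      partialTrace tr A ((ρ (drinfeldMu R) ⊗ₜ[k] 1) * repBase ρ s (theta F) * X *
        repBase ρ s (zeta F)) := by
  rw [dress, theta, zeta]
  generalize (F : U ⊗[k] (U ⊗[k] L)) = p
  generalize ((F⁻¹ : (U ⊗[k] (U ⊗[k] L))ˣ) : U ⊗[k] (U ⊗[k] L)) = q
  induction p with
  | zero => simp
  | add x y hx hy => simp only [map_add, mul_add, add_mul, hx, hy]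
  | tmul u p =>
  induction p with
  | zero => simp
  | add x y hx hy => simp only [map_add, mul_add, add_mul, TensorProduct.tmul_add, hx, hy]
  | tmul v l =>
  induction q with
  | zero => simp
  | add x y hx hy => simp only [map_add, mul_add, hx, hy]
  | tmul u' q =>
  induction q with
  | zero => simp
  | add x y hx hy => simp only [map_add, mul_add, TensorProduct.tmul_add, hx, hy]
  | tmul v' l' =>
    have h1 : ρ v' ⊗ₜ[k] s l' * (ρ (antipodeInv k U u') ⊗ₜ[k] (1 : A)) =
        repBase ρ s ((v' * antipodeInv k U u') ⊗ₜ[k] l') := by simp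
    have h2 : ρ (drinfeldMu R * (γ) (u * u')) ⊗ₜ[k] (1 : A) * (ρ v ⊗ₜ[k] s l) =
        (ρ (antipodeInv k U u') ⊗ₜ[k] (1 : A)) *
          ((ρ (drinfeldMu R) ⊗ₜ[k] (1 : A)) * repBase ρ s (((γ) u * v) ⊗ₜ[k] l)) := by
      -- At y = γ⁻¹(u') this reads γ⁻¹(u') μ = μ γ(u'); cyclicity then takes γ⁻¹(u') to the far
      -- right, as in ζ.
      have h3 := hR.mul_drinfeldMu (antipodeInv k U u')
      rw [hR.antipode_antipodeInv] at h3
      have h4 : ρ (drinfeldMu R * (γ) (u * u')) * ρ v =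
          ρ (antipodeInv k U u') * (ρ (drinfeldMu R) * ρ ((γ) u * v)) := by
        rw [HopfAlgebra.antipode_mul_antidistrib, ← mul_assoc, ← h3]
        simp only [map_mul, mul_assoc]
      rw [repBase_tmul, Algebra.TensorProduct.tmul_mul_tmul, Algebra.TensorProduct.tmul_mul_tmul,
        Algebra.TensorProduct.tmul_mul_tmul, h4, one_mul, one_mul]
    simp only [onRight_tmul, Algebra.TensorProduct.tmul_mul_tmul, mul_one,
      TensorProduct.assoc_symm_tmul, LinearMap.rTensor_tmul, LinearMap.comp_apply,
      LinearMap.mul'_apply, LinearEquiv.coe_coe, TensorProduct.comm_tmul, LinearMap.lTensor_tmul]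
    rw [twistedTrace_tmul_eq_partialTrace, ← h1, ← mul_assoc, ← mul_assoc, repBase_tmul, h2,
      ← mul_assoc (_ * _) (ρ v' ⊗ₜ[k] s l'), partialTrace_mul_tmul_one htr]
    simp only [mul_assoc, repBase_tmul]

end CentralityR

/-! ### Dictionary between End(V) ⊗ A and matrices with entries in A -/

section Matrices

variable {k U L A ι : Type*} [Field k] [Ring U] [HopfAlgebra k U]
  [Ring L] [Algebra k L] [Ring A] [Algebra k A] [Fintype ι] [DecidableEq ι]

/-- `End(V) ⊗ A` as matrices with entries in `A`. -/
def tensorMatrix (k ι A : Type*) [Field k] [Ring A] [Algebra k A] [Fintype ι] [DecidableEq ι] :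
    Matrix ι ι k ⊗[k] A ≃ₐ[k] Matrix ι ι A :=
  (Algebra.TensorProduct.comm k (Matrix ι ι k) A).trans (matrixEquivTensor ι k A).symm

@[simp] lemma tensorMatrix_tmul (e : Matrix ι ι k) (a : A) :
    tensorMatrix k ι A (e ⊗ₜ[k] a) = Matrix.of fun i j => e i j • a := by
  ext i j
  simp [tensorMatrix, matrixEquivTensor_apply_symm, Algebra.smul_def, Algebra.commutes]

lemma tensorMatrix_one_tmul (a : A) :
    tensorMatrix k ι A (1 ⊗ₜ[k] a) = Matrix.scalar ι a := by
  rw [tensorMatrix_tmul]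
  ext i j
  by_cases h : i = j <;> simp [Matrix.one_apply, h]

/-- `End(V) ⊗ End(V) ⊗ A` as matrices with entries in `A`. -/
def tensorMatrixTwo (k ι A : Type*) [Field k] [Ring A] [Algebra k A] [Fintype ι] [DecidableEq ι] :
    Matrix ι ι k ⊗[k] (Matrix ι ι k ⊗[k] A) ≃ₐ[k] Matrix (ι × ι) (ι × ι) A :=
  (Algebra.TensorProduct.congr AlgEquiv.refl (tensorMatrix k ι A)).trans
    ((tensorMatrix k ι (Matrix ι ι A)).trans (Matrix.compAlgEquiv ι ι A k))

lemma tensorMatrixTwo_tmul_apply (e : Matrix ι ι k) (z : Matrix ι ι k ⊗[k] A) (p q : ι × ι) :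
    tensorMatrixTwo k ι A (e ⊗ₜ[k] z) p q = e p.1 q.1 • tensorMatrix k ι A z p.2 q.2 := by
  simp [tensorMatrixTwo]

lemma repOne_map (ρ : U →ₐ[k] Matrix ι ι k) (s : L →ₐ[k] A) (x : U ⊗[k] L) :
    (repOne ρ x).map s = tensorMatrix k ι A (repBase ρ s x) := by
  ext i j
  simp only [repOne, Matrix.map_apply, Matrix.of_apply]
  induction x with
  | zero => simp
  | add x y hx hy => simp only [map_add, Matrix.add_apply, hx, hy]
  | tmul u l => simp [entryFirst]

lemma repTwo_map (ρ : U →ₐ[k] Matrix ι ι k) (s : L →ₐ[k] A) (x : U ⊗[k] (U ⊗[k] L)) :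
    (repTwo ρ x).map s = tensorMatrixTwo k ι A (repTwist ρ s x) := by
  ext p q
  simp only [repTwo, Matrix.map_apply, Matrix.of_apply]
  induction x with
  | zero => simp
  | add x y hx hy => simp only [map_add, Matrix.add_apply, hx, hy]
  | tmul u x =>
    rw [repTwist_tmul, tensorMatrixTwo_tmul_apply, ← repOne_map]
    simp [entryFirst, repOne]

open scoped Kronecker in
lemma secondLeg_tensorMatrix (K : Matrix ι ι k ⊗[k] A) :
    secondLeg (tensorMatrix k ι A K) = tensorMatrixTwo k ι A (1 ⊗ₜ[k] K) := by
  ext p q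
  simp [tensorMatrixTwo_tmul_apply, secondLeg, Matrix.kroneckerMap_apply, Matrix.one_apply]

lemma flipMatrix_mul_apply (M : Matrix (ι × ι) (ι × ι) A) (p q : ι × ι) :
    (flipMatrix ι A * M) p q = M p.swap q := by
  have : ∀ r : ι × ι, p = r.swap ↔ p.swap = r := fun r =>
    ⟨fun h => by rw [h, Prod.swap_swap], fun h => by rw [← h, Prod.swap_swap]⟩
  simp [flipMatrix, Matrix.mul_apply, this]

lemma mul_flipMatrix_apply (M : Matrix (ι × ι) (ι × ι) A) (p q : ι × ι) :
    (M * flipMatrix ι A) p q = M p q.swap := by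
  simp [flipMatrix, Matrix.mul_apply]

lemma flipMatrix_conj (z : Matrix ι ι k ⊗[k] (Matrix ι ι k ⊗[k] A)) :
    flipMatrix ι A * tensorMatrixTwo k ι A z * flipMatrix ι A =
      tensorMatrixTwo k ι A (Algebra.TensorProduct.leftComm k _ _ A z) := by
  ext p q
  rw [mul_flipMatrix_apply, flipMatrix_mul_apply]
  induction z with
  | zero => simp
  | add x y hx hy => simp only [map_add, Matrix.add_apply, hx, hy]
  | tmul e z =>
  induction z with
  | zero => simp
  | add x y hx hy => simp only [map_add, TensorProduct.tmul_add, Matrix.add_apply, hx, hy]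
  | tmul e' a =>
    simp [tensorMatrixTwo_tmul_apply, smul_smul, mul_comm]

lemma flipMatrix_mul_self : flipMatrix ι A * flipMatrix ι A = 1 := by
  ext p q
  rw [flipMatrix_mul_apply]
  simp [flipMatrix, Matrix.one_apply, Prod.swap_inj]

lemma flipMatrix_map {κ : Type*} [DecidableEq κ] (s : L →ₐ[k] A) :
    (flipMatrix κ L).map s = flipMatrix κ A := by
  ext p q
  simp only [flipMatrix, Matrix.map_apply, Matrix.of_apply]
  split_ifs <;> simp

lemma partialTrace_eq_trace (z : Matrix ι ι k ⊗[k] A) :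
    partialTrace (Matrix.traceLinearMap ι k k) A z = Matrix.trace (tensorMatrix k ι A z) := by
  induction z with
  | zero => simp
  | add x y hx hy => simp only [map_add, Matrix.trace_add, hx, hy]
  | tmul e a => simp [Matrix.trace, Finset.sum_smul]

lemma dynTrace_eq_partialTrace (ρ : U →ₐ[k] Matrix ι ι k) (R : (U ⊗[k] U)ˣ)
    (F : (U ⊗[k] (U ⊗[k] L))ˣ) (s : L →ₐ[k] A) (X : Matrix ι ι k ⊗[k] A) :
    dynTrace ρ R F s (tensorMatrix k ι A X) =
      partialTrace (Matrix.traceLinearMap ι k k) A ((ρ (drinfeldMu R) ⊗ₜ[k] 1) *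
        repBase ρ s (theta F) * X * repBase ρ s (zeta F)) := by
  have h : ∀ e : Matrix ι ι k, e.map (algebraMap k A) = tensorMatrix k ι A (e ⊗ₜ[k] 1) := by
    intro e
    ext i j
    simp [Algebra.algebraMap_eq_smul_one]
  rw [partialTrace_eq_trace, map_mul, map_mul, map_mul, dynTrace, h, repOne_map, repOne_map]

/-- The reflection equation in terms of `S = P R` amounts to the one in terms of `R`. -/
lemma reflection_of_flipMatrix (x K : Matrix ι ι k ⊗[k] (Matrix ι ι k ⊗[k] A))
    (h : flipMatrix ι A * tensorMatrixTwo k ι A x * tensorMatrixTwo k ι A K *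
        (flipMatrix ι A * tensorMatrixTwo k ι A x) * tensorMatrixTwo k ι A K =
      tensorMatrixTwo k ι A K * (flipMatrix ι A * tensorMatrixTwo k ι A x) *
        tensorMatrixTwo k ι A K * (flipMatrix ι A * tensorMatrixTwo k ι A x)) :
    Algebra.TensorProduct.leftComm k _ _ A x * Algebra.TensorProduct.leftComm k _ _ A K * x * K =
      K * Algebra.TensorProduct.leftComm k _ _ A x *
        Algebra.TensorProduct.leftComm k _ _ A K * x := by
  apply (tensorMatrixTwo k ι A).injective
  simp only [map_mul, ← flipMatrix_conj]
  have hP : ∀ M : Matrix (ι × ι) (ι × ι) A, flipMatrix ι A * (flipMatrix ι A * M) = M := fun M => by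
    rw [← mul_assoc, flipMatrix_mul_self, one_mul]
  simp only [mul_assoc, hP] at h ⊢
  exact h

end Matrices

/-! ### Exchange relations in the smash product -/

section Smash

variable {k H A L : Type*} [Field k] [Ring H] [HopfAlgebra k H] [Ring A] [Algebra k A]
  [Ring L] [Algebra k L]

/-- The embedding `a ↦ a ⊗ 1` of `A` in the smash product, as a homomorphism of algebras. -/
def SmashProduct.inlHom (α : ModuleAlgebra k H A) (B : BaseAlgebra k H L) :
    A →ₐ[k] SmashProduct α B :=
  AlgHom.ofLinearMap ((TensorProduct.mk k A L).flip 1 : A →ₗ[k] A ⊗[k] L) rfl (fun a b => by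
    change (a * b) ⊗ₜ[k] (1 : L) = smashMul α B (a ⊗ₜ[k] 1) (b ⊗ₜ[k] 1)
    simp [smashMul_tmul])

lemma SmashProduct.inlHom_mul_inr (α : ModuleAlgebra k H A) (B : BaseAlgebra k H L) (a : A)
    (l : L) : SmashProduct.inlHom α B a * SmashProduct.inr α B l = (a ⊗ₜ[k] l : A ⊗[k] L) := by
  change smashMul α B (a ⊗ₜ[k] 1) (1 ⊗ₜ[k] l) = _
  simp [smashMul_one_tmul]

lemma SmashProduct.inr_mul_inlHom (α : ModuleAlgebra k H A) (B : BaseAlgebra k H L) (a : A)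
    (l : L) : SmashProduct.inr α B l * SmashProduct.inlHom α B a =
      LinearMap.mul' k (SmashProduct α B) (TensorProduct.map
        ((SmashProduct.inlHom α B).toLinearMap ∘ₗ α.act.toLinearMap.flip a)
        (SmashProduct.inr α B).toLinearMap (B.coact l)) := by
  have h : ∀ t : H ⊗[k] L, smashTensor α L t (a ⊗ₜ[k] (1 : L)) =
      LinearMap.mul' k (SmashProduct α B) (TensorProduct.map
        ((SmashProduct.inlHom α B).toLinearMap ∘ₗ α.act.toLinearMap.flip a)
        (SmashProduct.inr α B).toLinearMap t) := by
    intro t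
    induction t with
    | zero => simp; rfl
    | add x y hx hy => simp only [map_add, LinearMap.add_apply, hx, hy]; rfl
    | tmul h m =>
      simp only [TensorProduct.map_tmul, LinearMap.mul'_apply, LinearMap.comp_apply,
        AlgHom.toLinearMap_apply, SmashProduct.inlHom_mul_inr, smashTensor_tmul, mul_one]
      rfl
  refine Eq.trans ?_ (h (B.coact l))
  change smashMul α B (1 ⊗ₜ[k] l) (a ⊗ₜ[k] 1) = _
  simp [smashMul_tmul, smashRight]

end Smash

/-! ### From the exchange relation to commutation with the coaction -/

section Exchange

variable {k H E L A : Type*} [Field k] [Ring H] [HopfAlgebra k H] [Ring E] [Algebra k E]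
  [Ring L] [Algebra k L] [Ring A] [Algebra k A]

/-- `h ⊗ h' ↦ π(γ(h)) K π(h')`. -/
def adjointConj (π : H →ₐ[k] E) (K : E ⊗[k] A) : H ⊗[k] H →ₗ[k] E ⊗[k] A :=
  LinearMap.mul' k (E ⊗[k] A) ∘ₗ TensorProduct.map
    (LinearMap.mulRight k K ∘ₗ (TensorProduct.mk k E A).flip 1 ∘ₗ π.toLinearMap ∘ₗ
      HopfAlgebra.antipode k)
    ((TensorProduct.mk k E A).flip 1 ∘ₗ π.toLinearMap)

@[simp] lemma adjointConj_tmul (π : H →ₐ[k] E) (K : E ⊗[k] A) (h h' : H) :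
    adjointConj π K (h ⊗ₜ[k] h') =
      (π (HopfAlgebra.antipode k h) ⊗ₜ[k] 1) * K * (π h' ⊗ₜ[k] 1) := by
  simp [adjointConj]

/-- `h ⊗ l ↦ π(γ(h⁽¹⁾)) K π(h⁽²⁾) s(l)`. -/
def adjointExchange (π : H →ₐ[k] E) (s : L →ₐ[k] A) (K : E ⊗[k] A) : H ⊗[k] L →ₗ[k] E ⊗[k] A :=
  LinearMap.mul' k (E ⊗[k] A) ∘ₗ TensorProduct.map (adjointConj π K ∘ₗ Coalgebra.comul)
    (TensorProduct.mk k E A 1 ∘ₗ s.toLinearMap)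

@[simp] lemma adjointExchange_tmul (π : H →ₐ[k] E) (s : L →ₐ[k] A) (K : E ⊗[k] A) (h : H) (l : L) :
    adjointExchange π s K (h ⊗ₜ[k] l) =
      adjointConj π K (Coalgebra.comul (R := k) h) * (1 ⊗ₜ[k] s l) := by
  simp [adjointExchange]

/-- The cancellation h⁽¹⁾γ(h⁽²⁾) K h⁽³⁾ = K h. -/
lemma mul_adjointConj_comul (π : H →ₐ[k] E) (K : E ⊗[k] A) (h : H) :
    LinearMap.mul' k (E ⊗[k] A) (TensorProduct.map ((TensorProduct.mk k E A).flip 1 ∘ₗ π.toLinearMap)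
      (adjointConj π K ∘ₗ Coalgebra.comul) (Coalgebra.comul (R := k) h)) =
      K * (π h ⊗ₜ[k] 1) := by
  set N : H ⊗[k] (H ⊗[k] H) →ₗ[k] E ⊗[k] A := LinearMap.mul' k (E ⊗[k] A) ∘ₗ
    TensorProduct.map ((TensorProduct.mk k E A).flip 1 ∘ₗ π.toLinearMap) (adjointConj π K) with hN
  have h1 : ∀ t : H ⊗[k] H, LinearMap.mul' k (E ⊗[k] A)
      (TensorProduct.map ((TensorProduct.mk k E A).flip 1 ∘ₗ π.toLinearMap)
      (adjointConj π K ∘ₗ Coalgebra.comul) t) = N ((Coalgebra.comul (R := k)).lTensor H t) := by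
    intro t
    induction t with
    | zero => simp
    | add x y hx hy => simp only [map_add, hx, hy]
    | tmul a b => simp [hN]
  have h2 : ∀ t : H ⊗[k] H, N (TensorProduct.assoc k H H H
      ((Coalgebra.comul (R := k)).rTensor H t)) =
      K * (π (TensorProduct.lid k H ((Coalgebra.counit (R := k)).rTensor H t)) ⊗ₜ[k] 1) := by
    intro t
    induction t with
    | zero => simp
    | add x y hx hy => simp only [map_add, TensorProduct.add_tmul, mul_add, hx, hy]
    | tmul a c =>
      have h3 : ∀ u : H ⊗[k] H, N (TensorProduct.assoc k H H H (u ⊗ₜ[k] c)) =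
          (π (LinearMap.mul' k H ((HopfAlgebra.antipode k).lTensor H u)) ⊗ₜ[k] 1) * K *
            (π c ⊗ₜ[k] 1) := by
        intro u
        induction u with
        | zero => simp
        | add x y hx hy => simp only [map_add, TensorProduct.add_tmul, add_mul, hx, hy]
        | tmul x y => simp [hN, ← mul_assoc]
      rw [LinearMap.rTensor_tmul, h3, HopfAlgebra.mul_antipode_lTensor_comul_apply,
        AlgHom.commutes, Algebra.algebraMap_eq_smul_one, ← TensorProduct.smul_tmul',
        ← Algebra.TensorProduct.one_def]
      simp [← TensorProduct.smul_tmul']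
  rw [h1, ← Coalgebra.coassoc_apply, h2, Coalgebra.rTensor_counit_comul]
  simp

/-- Multiplying the exchange relation for l^[∞] by π(l⁽¹⁾) cancels the antipode factor of the
coadjoint action, by coassociativity of δ. -/
lemma commute_coact_of_exchange (π : H →ₐ[k] E) (s : L →ₐ[k] A) (B : BaseAlgebra k H L)
    (K : E ⊗[k] A)
    (hK : ∀ l, (1 ⊗ₜ[k] s l) * K = adjointExchange π s K (B.coact l)) (l : L) :
    Commute (Algebra.TensorProduct.map π s (B.coact l)) K := by
  set Λ : H ⊗[k] (H ⊗[k] L) →ₗ[k] E ⊗[k] A := LinearMap.mul' k (E ⊗[k] A) ∘ₗ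
    TensorProduct.map ((TensorProduct.mk k E A).flip 1 ∘ₗ π.toLinearMap) (adjointExchange π s K)
    with hΛ
  have h1 : ∀ t : H ⊗[k] L, Algebra.TensorProduct.map π s t * K =
      Λ (B.coact.toLinearMap.lTensor H t) := by
    intro t
    induction t with
    | zero => simp
    | add x y hx hy => simp only [map_add, add_mul, hx, hy]
    | tmul h m =>
      have h3 : π h ⊗ₜ[k] s m = (π h ⊗ₜ[k] (1 : A)) * ((1 : E) ⊗ₜ[k] s m) := by simp
      rw [Algebra.TensorProduct.map_tmul, h3, mul_assoc, hK]
      simp [hΛ]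
  have h2 : ∀ t : H ⊗[k] L, Λ (TensorProduct.assoc k H H L
      ((Coalgebra.comul (R := k)).rTensor L t)) = K * Algebra.TensorProduct.map π s t := by
    intro t
    induction t with
    | zero => simp
    | add x y hx hy => simp only [map_add, mul_add, hx, hy]
    | tmul h m =>
      have h3 : ∀ u : H ⊗[k] H, Λ (TensorProduct.assoc k H H L (u ⊗ₜ[k] m)) =
          LinearMap.mul' k (E ⊗[k] A)
            (TensorProduct.map ((TensorProduct.mk k E A).flip 1 ∘ₗ π.toLinearMap)
            (adjointConj π K ∘ₗ Coalgebra.comul) u) * (1 ⊗ₜ[k] s m) := by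
        intro u
        induction u with
        | zero => simp
        | add x y hx hy => simp only [map_add, TensorProduct.add_tmul, add_mul, hx, hy]
        | tmul x y => simp [hΛ, mul_assoc]
      rw [LinearMap.rTensor_tmul, h3, mul_adjointConj_comul, mul_assoc]
      simp
  rw [Commute, SemiconjBy, h1, ← B.coact_coassoc, h2]

end Exchange

/-! ### Relations and generators of the dRE algebra -/

section Generators

variable {k H L ι : Type*} [Field k] [Ring H] [HopfAlgebra k H] [Ring L] [Algebra k L]
  [Fintype ι] [DecidableEq ι]

variable (π : H →ₐ[k] Matrix ι ι k) (B : BaseAlgebra k H L) (S : Matrix (ι × ι) (ι × ι) L)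

lemma reflection_dreK :
    S.map (dreSource π B S) * secondLeg (dreK π B S) * S.map (dreSource π B S) *
        secondLeg (dreK π B S) =
      secondLeg (dreK π B S) * S.map (dreSource π B S) * secondLeg (dreK π B S) *
        S.map (dreSource π B S) := by
  set q := RingQuot.mkAlgHom k (DRERel π B S) with hq
  have h1 : S.map (dreSource π B S) = (S.map (SmashProduct.inr (coadjoint π) B)).map q := by
    ext i j; rfl
  have h2 : secondLeg (dreK π B S) = (secondLeg (freeK π B)).map q := by
    ext i j
    simp only [secondLeg, Matrix.kroneckerMap_apply, Matrix.map_apply, Matrix.one_apply, dreK]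
    split_ifs <;> simp [hq]
  rw [h1, h2]
  simp only [← Matrix.map_mul]
  ext p r
  exact RingQuot.mkAlgHom_rel k (DRERel.entry p r)

lemma dreK_apply (i l : ι) : dreK π B S i l = RingQuot.mkAlgHom k (DRERel π B S)
    (SmashProduct.inlHom (coadjoint π) B (FreeAlgebra.ι k (i, l))) := rfl

/-- The smash product rule l a = (l⁽¹⁾ ▹ a) l^[∞] on the generators, collected into one matrix
identity. -/
lemma dreSource_mul_dreK (l : L) :
    (1 ⊗ₜ[k] dreSource π B S l) * (tensorMatrix k ι _).symm (dreK π B S) =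
      adjointExchange π (dreSource π B S) ((tensorMatrix k ι _).symm (dreK π B S))
        (B.coact l) := by
  apply (tensorMatrix k ι (DREAlgebra π B S)).injective
  ext i j
  have h1 : tensorMatrix k ι (DREAlgebra π B S) ((1 ⊗ₜ[k] dreSource π B S l) *
      (tensorMatrix k ι _).symm (dreK π B S)) i j = dreSource π B S l * dreK π B S i j := by
    rw [map_mul, AlgEquiv.apply_symm_apply, tensorMatrix_tmul, Matrix.mul_apply]
    simp [Matrix.one_apply]
  have hs : dreSource π B S l = RingQuot.mkAlgHom k (DRERel π B S)
      (SmashProduct.inr (coadjoint π) B l) := rfl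
  rw [h1, dreK_apply, hs, ← map_mul, SmashProduct.inr_mul_inlHom]
  generalize B.coact l = t
  induction t with
  | zero => simp
  | add x y hx hy => simp only [map_add, Matrix.add_apply, hx, hy]
  | tmul h m =>
    have h2 : ∀ u : H ⊗[k] H, tensorMatrix k ι (DREAlgebra π B S)
        (adjointConj π ((tensorMatrix k ι _).symm (dreK π B S)) u) i j =
        ∑ a, ∑ b, LinearMap.mul' k k (TensorProduct.map
          (Matrix.entryLinearMap k k i a ∘ₗ π.toLinearMap ∘ₗ HopfAlgebra.antipode k)
          (Matrix.entryLinearMap k k b j ∘ₗ π.toLinearMap) u) • dreK π B S a b := by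
      intro u
      induction u with
      | zero => simp
      | add x y hx hy => simp only [map_add, Matrix.add_apply, hx, hy, add_smul,
          Finset.sum_add_distrib]
      | tmul x y =>
        rw [adjointConj_tmul, map_mul, map_mul, AlgEquiv.apply_symm_apply, tensorMatrix_tmul,
          tensorMatrix_tmul, Matrix.mul_apply, Finset.sum_comm]
        refine Finset.sum_congr rfl fun b _ => ?_
        rw [Matrix.mul_apply, Finset.sum_mul]
        refine Finset.sum_congr rfl fun a _ => ?_
        simp [smul_smul, mul_comm]
    have h3 : (coadjoint π).act h (FreeAlgebra.ι k (i, j)) =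
        ∑ a, ∑ b, coadjointCoeff π i a b j h • FreeAlgebra.ι k (a, b) := by
      change coadjointLin π h (FreeAlgebra.ι k (i, j)) = _
      simp [coadjointConv, coadjointGen]
    rw [adjointExchange_tmul, map_mul, tensorMatrix_one_tmul, Matrix.scalar_apply, Matrix.mul_diagonal, h2]
    simp only [TensorProduct.map_tmul, LinearMap.mul'_apply, LinearMap.comp_apply,
      AlgHom.toLinearMap_apply, LinearMap.flip_apply, h3, map_mul, map_sum, map_smul]
    rfl

lemma commute_of_commute_generators (T : DREAlgebra π B S)
    (hK : ∀ i j, Commute (dreK π B S i j) T) (hL : ∀ l, Commute (dreSource π B S l) T)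
    (x : DREAlgebra π B S) : Commute x T := by
  obtain ⟨y, rfl⟩ := RingQuot.mkAlgHom_surjective k (DRERel π B S) x
  set q := RingQuot.mkAlgHom k (DRERel π B S) with hq
  have h1 : ∀ a, Commute (q (SmashProduct.inlHom (coadjoint π) B a)) T := by
    intro a
    induction a using FreeAlgebra.induction with
    | grade0 r => rw [AlgHom.commutes, AlgHom.commutes]; exact Algebra.commutes r T
    | grade1 p => exact hK p.1 p.2
    | mul x y hx hy => rw [map_mul, map_mul]; exact hx.mul_left hy
    | add x y hx hy => rw [map_add, map_add]; exact hx.add_left hy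
  -- The smash product is the tensor product as a space, and a ⊗ l is the product of a and l in it,
  -- so pure tensors suffice.
  have h2 : ∀ y : FreeAlgebra k (ι × ι) ⊗[k] L,
      Commute (q (show SmashProduct (coadjoint π) B from y)) T := by
    intro y
    induction y with
    | zero => exact (congrArg (Commute · T) (map_zero q)).mpr (Commute.zero_left T)
    | add x y hx hy => exact (congrArg (Commute · T) (map_add q _ _)).mpr (hx.add_left hy)
    | tmul a l =>
      have h3 := (h1 a).mul_left (hL l)
      change Commute (_ * q (SmashProduct.inr (coadjoint π) B l)) T at h3
      rw [← map_mul, SmashProduct.inlHom_mul_inr] at h3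
      exact h3
  exact h2 y

end Generators

end DynRE

end

/-! ### The centrality theorem -/

theorem mainTheorem2 {k H U L V ι : Type*} [Field k] [CharZero k]
    [Ring H] [HopfAlgebra k H] [Ring U] [HopfAlgebra k U] [Ring L] [Algebra k L]
    (j : H →ₐc[k] U) (_hj : Function.Injective j)
    (B : DynRE.BaseAlgebra k H L)
    (R : (U ⊗[k] U)ˣ) (_hR : DynRE.IsUniversalRMatrix R)
    (F : (U ⊗[k] (U ⊗[k] L))ˣ) (_hF : DynRE.IsDynamicalTwist j B F)
    [AddCommGroup V] [Module k V] [Fintype ι] [DecidableEq ι] (b : Module.Basis ι k V)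
    (ρ : U →ₐ[k] Module.End k V) (n : ℕ) :
    DynRE.dynTrace (DynRE.matrixRep b ρ) R F
        (DynRE.dreSource ((DynRE.matrixRep b ρ).comp (j : H →ₐ[k] U)) B
          (DynRE.dynS (DynRE.matrixRep b ρ) R F))
        (DynRE.dreK ((DynRE.matrixRep b ρ).comp (j : H →ₐ[k] U)) B
          (DynRE.dynS (DynRE.matrixRep b ρ) R F) ^ n) ∈
      Subalgebra.center k
        (DynRE.DREAlgebra ((DynRE.matrixRep b ρ).comp (j : H →ₐ[k] U)) B
          (DynRE.dynS (DynRE.matrixRep b ρ) R F)) := by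
  set r := DynRE.matrixRep b ρ
  set S := DynRE.dynS r R F with hS
  set π := r.comp (j : H →ₐ[k] U) with hπ
  set s := DynRE.dreSource π B S
  set K := (DynRE.tensorMatrix k ι _).symm (DynRE.dreK π B S) with hK
  have hKm : DynRE.dreK π B S = DynRE.tensorMatrix k ι _ K := (AlgEquiv.apply_symm_apply _ _).symm
  have htr : ∀ x y : Matrix ι ι k, Matrix.traceLinearMap ι k k (x * y) =
      Matrix.traceLinearMap ι k k (y * x) := fun x y => Matrix.trace_mul_comm x y
  have hKc : ∀ l, Commute (DynRE.repBase r s (DynRE.coactU j B l)) K := by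
    intro l
    have h1 : ∀ t : H ⊗[k] L, DynRE.repBase r s
        (Algebra.TensorProduct.map (j : H →ₐ[k] U) (AlgHom.id k L) t) =
        Algebra.TensorProduct.map π s t := by
      intro t
      induction t with
      | zero => simp
      | add x y hx hy => simp only [map_add, hx, hy]
      | tmul h m => simp [hπ]
    have h2 := DynRE.commute_coact_of_exchange π s B K (DynRE.dreSource_mul_dreK π B S) l
    rw [← h1] at h2
    exact h2
  have hRE := DynRE.reflection_of_flipMatrix (DynRE.repTwist r s (DynRE.dynR R F)) (1 ⊗ₜ[k] K) (by
    have h := DynRE.reflection_dreK π B S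
    have h1 : S.map s = DynRE.flipMatrix ι _ *
        DynRE.tensorMatrixTwo k ι _ (DynRE.repTwist r s (DynRE.dynR R F)) := by
      rw [← DynRE.repTwo_map, ← DynRE.flipMatrix_map s, ← Matrix.map_mul]
      rfl
    rw [hKm, DynRE.secondLeg_tensorMatrix, h1] at h
    exact h)
  have hT : DynRE.dynTrace r R F s (DynRE.dreK π B S ^ n) = DynRE.twistedTrace
      (Matrix.traceLinearMap ι k k) r (DynRE.drinfeldMu R) _ (DynRE.dress r s F (K ^ n)) := by
    rw [hKm, ← map_pow, DynRE.dynTrace_eq_partialTrace, DynRE.twistedTrace_dress _hR htr]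
  rw [hT, Subalgebra.mem_center_iff]
  refine DynRE.commute_of_commute_generators π B S _ ?_ ?_
  · intro i l
    -- As matrices, 1 ⊗ T is the scalar matrix T, so commuting with K means that T commutes with
    -- each entry of K.
    have h := congrArg (DynRE.tensorMatrix k ι _)
      (DynRE.commute_generator_twistedTrace (tr := Matrix.traceLinearMap ι k k) _hR _hF hKc htr
        hRE n).eq
    rw [map_mul, map_mul, ← hKm, DynRE.tensorMatrix_one_tmul, Matrix.scalar_apply] at h
    rw [Commute, SemiconjBy]
    simpa using congrFun (congrFun h i) l
  · exact _hF.commute_base_twistedTrace (fun l => (hKc l).pow_right n) htr _hR.isTwistingElement
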